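/- Let $r\ge 3$ be an integer. For $p_0\in(0,1)$ consider the system of differential equations on $[0,\infty)$ $$w'=-rs,\qquad b'=-b-rt+rs,\qquad q'=-\frac{(2r-2)qs}{w},$$ $$s'=-s+\frac{(r-1)qs}{w}-\frac{(r-1)s^2}{w}-\frac{r(r-2)st}{(r-1)b},\qquad t'=-2t+\frac{2(r-1)s^2}{w}-\frac{2r(r-2)t^2}{(r-1)b},$$ with initial conditions $w(0)=(1-p_0)^{r+1}$, $b(0)=rp_0(1-p_0)^r$, $q(0)=(1-p_0)^{2r}$, $s(0)=(r-1)p_0(1-p_0)^{2r-1}$, $t(0)=(r-1)^2p_0^2(1-p_0)^{2r-2}$. For its positive solution put $$\xi(r,p_0)=p_0(1-p_0)^r+\int_0^\infty b(x)\,dx+\begin{cases}\lim_{x\to\infty}w(x)&\text{if }\lim_{x\to\infty}\frac{(r-1)q(x)}{w(x)}<1,\\0&\text{otherwise,}\end{cases}$$ and let $\xi(r)=\sup_{0<p_0<1}\xi(r,p_0)$. Then: (a) for every $p_0\in(0,1)$ a positive solution on $[0,\infty)$ exists for which the integral converges and the limits exist, and the number $\xi(r,p_0)$ is uniquely determined;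 the supremum $\xi(r)$ is finite; (b) for $r=3,4,\dots,10$ the constant $\xi(r)$ is at least $0.7268$, $0.6045$, $0.5269$, $0.4711$, $0.4283$, $0.3940$, $0.3658$, $0.3419$, respectively; (c) for every fixed $\varepsilon>0$, the probability that a uniformly random labelled $r$-regular simple graph on $n$ vertices contains an induced forest (an acyclic induced subgraph) with at least $(\xi(r)-\varepsilon)n$ vertices tends to $1$ as $n\to\infty$ over the integers $n$ with $rn$ even. -/

import Mathlib

open Filter Topology MeasureTheory

noncomputable section

namespace InducedForest

/-- `(w, b, q, s, t)` is a positive solution on `[0, ∞)` of the system of differential equations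
associated with `(r, p₀)`. At the endpoint `0` the derivative is one-sided, at every other point
it is the ordinary derivative. -/
structure IsSolution (r : ℕ) (p₀ : ℝ) (w b q s t : ℝ → ℝ) : Prop where
  w_pos : ∀ x, 0 ≤ x → 0 < w x
  b_pos : ∀ x, 0 ≤ x → 0 < b x
  q_pos : ∀ x, 0 ≤ x → 0 < q x
  s_pos : ∀ x, 0 ≤ x → 0 < s x
  t_pos : ∀ x, 0 ≤ x → 0 < t x
  w_zero : w 0 = (1 - p₀) ^ (r + 1)
  b_zero : b 0 = r * p₀ * (1 - p₀) ^ r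
  q_zero : q 0 = (1 - p₀) ^ (2 * r)
  s_zero : s 0 = ((r : ℝ) - 1) * p₀ * (1 - p₀) ^ (2 * r - 1)
  t_zero : t 0 = ((r : ℝ) - 1) ^ 2 * p₀ ^ 2 * (1 - p₀) ^ (2 * r - 2)
  w_deriv : ∀ x, 0 ≤ x → HasDerivWithinAt w (-(r * s x)) (Set.Ici 0) x
  b_deriv : ∀ x, 0 ≤ x → HasDerivWithinAt b (-b x - r * t x + r * s x) (Set.Ici 0) x
  q_deriv : ∀ x, 0 ≤ x →
    HasDerivWithinAt q (-((2 * (r : ℝ) - 2) * q x * s x / w x)) (Set.Ici 0) x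
  s_deriv : ∀ x, 0 ≤ x →
    HasDerivWithinAt s
      (-s x + ((r : ℝ) - 1) * q x * s x / w x - ((r : ℝ) - 1) * s x ^ 2 / w x
        - r * ((r : ℝ) - 2) * s x * t x / (((r : ℝ) - 1) * b x)) (Set.Ici 0) x
  t_deriv : ∀ x, 0 ≤ x →
    HasDerivWithinAt t
      (-2 * t x + 2 * ((r : ℝ) - 1) * s x ^ 2 / w x
        - 2 * r * ((r : ℝ) - 2) * t x ^ 2 / (((r : ℝ) - 1) * b x)) (Set.Ici 0) x

/-- `v` is the constant `ξ(r, p₀)`: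
`p₀ (1 - p₀) ^ r + ∫₀^∞ b + lim w` if `lim (r - 1) q / w < 1`, and
`p₀ (1 - p₀) ^ r + ∫₀^∞ b` otherwise, where `w`, `b`, `q` come from the solution of the system
associated with `(r, p₀)`. The integral has to converge and both limits have to exist. -/
def IsXi (r : ℕ) (p₀ v : ℝ) : Prop :=
  ∃ (w b q s t : ℝ → ℝ) (wLim ρ : ℝ),
    IsSolution r p₀ w b q s t ∧
    IntegrableOn b (Set.Ioi 0) ∧
    Tendsto w atTop (𝓝 wLim) ∧
    Tendsto (fun x => ((r : ℝ) - 1) * q x / w x) atTop (𝓝 ρ) ∧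
    v = p₀ * (1 - p₀) ^ r + (∫ x in Set.Ioi (0 : ℝ), b x) + (if ρ < 1 then wLim else 0)

/-- The set of all constants `ξ(r, p₀)`, `0 < p₀ < 1`. -/
def xiValues (r : ℕ) : Set ℝ := {v | ∃ p₀ ∈ Set.Ioo (0 : ℝ) 1, IsXi r p₀ v}

/-- `ξ(r)`, the best of the constants `ξ(r, p₀)`. -/
def xi (r : ℕ) : ℝ := sSup (xiValues r)

/-- Numerical values of the constants for `3 ≤ r ≤ 10` (not used for other `r`). -/
def xiTable : ℕ → ℝ
  | 3 => 0.7268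
  | 4 => 0.6045
  | 5 => 0.5269
  | 6 => 0.4711
  | 7 => 0.4283
  | 8 => 0.3940
  | 9 => 0.3658
  | 10 => 0.3419
  | _ => 0

open Classical in
/-- The set of all `r`-regular (simple, labelled) graphs on the vertex set `Fin n`. -/
def regularGraphs (r n : ℕ) : Set (SimpleGraph (Fin n)) := {G | G.IsRegularOfDegree r}

/-- The probability that a uniformly random `r`-regular graph on `n` vertices lies in `A`. -/
def regularProb (r n : ℕ) (A : Set (SimpleGraph (Fin n))) : ℝ :=
  ((regularGraphs r n ∩ A).ncard : ℝ) / ((regularGraphs r n).ncard : ℝ)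

/-- A random `r`-regular graph on `n` vertices is asymptotically almost surely in `A n`. The limit
`n → ∞` runs over those `n` for which `r * n` is even, as `r`-regular graphs on `n` vertices exist
for no other `n`. -/
def AAS (r : ℕ) (A : (n : ℕ) → Set (SimpleGraph (Fin n))) : Prop :=
  Tendsto (fun n => regularProb r n (A n)) (atTop ⊓ 𝓟 {n : ℕ | Even (r * n)}) (𝓝 1)

/-- `G` contains an induced forest with at least `m` vertices. -/
def HasInducedForest {n : ℕ} (G : SimpleGraph (Fin n)) (m : ℝ) : Prop :=
  ∃ S : Finset (Fin n), (G.induce (S : Set (Fin n))).IsAcyclic ∧ m ≤ (S.card : ℝ)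

end InducedForest

end

noncomputable section

namespace InducedForest


/-! The system has an explicit two-variable form. Write $a$ for the probability that a branch is
silent, $y$ for the blue mass, and $K(a)=(r-1)(1-p)a^{r-2}$. If $a'=-Ky$ and $y'=(K-1)y$ with
$a(0)=1-p$, $y(0)=p$, then $w=(1-p)a^r$, $b=r(1-p)a^{r-1}y$, $q=(1-p)^2a^{2r-2}$,
$s=(1-p)a^{r-1}Ky$, $t=(Ky)^2$ solve the system. Since $dy/da=-(1-1/K)$, the blue mass is the
function `blueMass` of $a$, and $a$ decreases to the largest zero $\alpha$ of it below $1-p$. There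
$K(\alpha)<1$, and $K$ is exactly $(r-1)q/w$, so the first case of the definition always applies.
Because $b$ is the derivative of $-\frac{r}{2(r-1)}a^2$, the constant is $p(1-p)^r$ plus
`forestGain` at $\alpha$ (`IsStop.isXi`). Uniqueness follows from the local Lipschitz property. For
numerical bounds it suffices to bound $\alpha$ from above (`le_xi`).

For the random graph no differential equation method is needed. Give the vertices independent
labels: seed with probability $p$, otherwise a geometric delay with parameter $\eta$. A non-seed
turns purple when its delay has elapsed after its first purple neighbour, provided that no second
neighbour has fired by then. The purple vertices, with the white vertices outside every white
subgraph of minimum degree two, induce a forest for every graph and every labelling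
(`isAcyclic_grownForest`).

If the ball around a vertex is a tree, the messages of different branches are independent, and the
membership probability is computed by a recursion on rounds (`Rooting.prob_grownForest_ge`). Since
geometric delays have no memory, this recursion is the Euler scheme of the two-variable system. Its
value approaches $\xi(r,p)$ as $\eta\to0$ (`exists_rounds`). A white core near the vertex would
force a long white chain, which is unlikely since $K<1$. Averaging over the labels gives a large
forest in every regular graph with few vertices near short cycles (`exists_large_forest`).
Switchings show that a random regular graph has boundedly many such vertices on average
(`sum_badVertices_le`), and Markov's inequality finishes the proof. -/

/-- The mean number of susceptible branches, `(r - 1) (1 - p) a ^ (r - 2)`, hanging off a white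
vertex when a branch is silent with probability `a`. -/
def branchRate (r : ℕ) (p a : ℝ) : ℝ := ((r : ℝ) - 1) * (1 - p) * a ^ (r - 2)

/-- The first integral of the system: the blue mass as a function of the silence probability. -/
def blueMass (r : ℕ) (p a : ℝ) : ℝ := p + ∫ v in a..(1 - p), (1 - 1 / branchRate r p v)

/-- The density of the forest, apart from the seeds, when the process stops at silence
probability `a`. -/
def forestGain (r : ℕ) (p a : ℝ) : ℝ :=
  r / (2 * ((r : ℝ) - 1)) * ((1 - p) ^ 2 - a ^ 2) + (1 - p) * a ^ r

/-! ### The first integral of the system and the stopping point. -/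

section

variable {r : ℕ} {p : ℝ}

lemma branchRate_pos (hr : 3 ≤ r) (hp : p < 1) {a : ℝ} (ha : 0 < a) : 0 < branchRate r p a := by
  have : (3 : ℝ) ≤ r := by exact_mod_cast hr
  have h1 : 0 < (r : ℝ) - 1 := by linarith
  have h2 : 0 < 1 - p := by linarith
  unfold branchRate
  positivity

lemma branchRate_mono (hr : 3 ≤ r) (hp : p < 1) {a b : ℝ} (ha : 0 ≤ a) (hab : a ≤ b) :
    branchRate r p a ≤ branchRate r p b := by
  have : (3 : ℝ) ≤ r := by exact_mod_cast hr
  have h1 : 0 < (r : ℝ) - 1 := by linarith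
  have h2 : 0 < 1 - p := by linarith
  unfold branchRate
  gcongr

lemma continuous_branchRate : Continuous (branchRate r p) := by
  unfold branchRate
  fun_prop

lemma continuousOn_integrand (hr : 3 ≤ r) (hp : p < 1) :
    ContinuousOn (fun v => 1 - 1 / branchRate r p v) (Set.Ioi 0) := by
  refine continuousOn_const.sub (continuousOn_const.div continuous_branchRate.continuousOn ?_)
  intro x hx
  exact (branchRate_pos hr hp hx).ne'

lemma intervalIntegrable_integrand (hr : 3 ≤ r) (hp : p < 1) {a b : ℝ} (ha : 0 < a) (hb : 0 < b) :
    IntervalIntegrable (fun v => 1 - 1 / branchRate r p v) volume a b := by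
  refine ((continuousOn_integrand hr hp).mono ?_).intervalIntegrable
  intro x hx
  exact lt_of_lt_of_le (lt_min ha hb) hx.1

lemma hasDerivAt_blueMass (hr : 3 ≤ r) (hp : p < 1) {a : ℝ} (ha : 0 < a) :
    HasDerivAt (blueMass r p) (-(1 - 1 / branchRate r p a)) a := by
  have hc := (continuousOn_integrand hr hp).continuousAt (Ioi_mem_nhds ha)
  have hm : StronglyMeasurableAtFilter (fun v => 1 - 1 / branchRate r p v) (𝓝 a) volume :=
    (continuousOn_integrand hr hp).stronglyMeasurableAtFilter isOpen_Ioi a ha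
  exact (intervalIntegral.integral_hasDerivAt_left
    (intervalIntegrable_integrand hr hp ha (by linarith)) hm hc).const_add p

lemma blueMass_sub (hr : 3 ≤ r) (hp : p < 1) {a b : ℝ} (ha : 0 < a) (hb : 0 < b) :
    blueMass r p a = blueMass r p b + ∫ v in a..b, (1 - 1 / branchRate r p v) := by
  unfold blueMass
  rw [← intervalIntegral.integral_add_adjacent_intervals
    (intervalIntegrable_integrand hr hp ha hb)
    (intervalIntegrable_integrand hr hp hb (sub_pos.2 hp))]
  ring

lemma blueMass_one_sub : blueMass r p (1 - p) = p := by simp [blueMass]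

/-- Concavity of the blue mass, in the form of a tangent line inequality. -/
lemma blueMass_le_tangent (hr : 3 ≤ r) (hp : p < 1) {a b : ℝ} (ha : 0 < a) (hab : a ≤ b) :
    blueMass r p a ≤ blueMass r p b + (b - a) * (1 - 1 / branchRate r p b) := by
  have hb : 0 < b := ha.trans_le hab
  rw [blueMass_sub hr hp ha hb]
  have h : ∫ v in a..b, (1 - 1 / branchRate r p v) ≤ ∫ v in a..b, (1 - 1 / branchRate r p b) := by
    refine intervalIntegral.integral_mono_on hab (intervalIntegrable_integrand hr hp ha hb)
      (by simp) ?_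
    intro x hx
    have hx0 : 0 < x := ha.trans_le hx.1
    have := one_div_le_one_div_of_le (branchRate_pos hr hp hx0) (branchRate_mono hr hp hx0.le hx.2)
    linarith
  rw [intervalIntegral.integral_const, smul_eq_mul] at h
  linarith

/-- From $K(v)\le(r-1)v$ on $(0,1]$. The logarithm makes the blue mass negative near $0$, which
forces the process to stop. -/
lemma blueMass_le_log (hr : 3 ≤ r) (hp0 : 0 < p) (hp : p < 1) {a : ℝ} (ha : 0 < a)
    (ha1 : a ≤ 1 - p) :
    blueMass r p a ≤ 1 - (1 / ((r : ℝ) - 1)) * Real.log ((1 - p) / a) := by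
  have h3 : (3 : ℝ) ≤ r := by exact_mod_cast hr
  have hI : IntervalIntegrable (fun v : ℝ => 1 - (1 / ((r : ℝ) - 1)) * v⁻¹) volume a (1 - p) := by
    refine ContinuousOn.intervalIntegrable ?_
    refine continuousOn_const.sub (continuousOn_const.mul (continuousOn_id.inv₀ ?_))
    intro x hx
    exact (lt_of_lt_of_le (lt_min ha (sub_pos.2 hp)) hx.1).ne'
  have h : ∫ v in a..(1 - p), (1 - 1 / branchRate r p v)
      ≤ ∫ v in a..(1 - p), (1 - (1 / ((r : ℝ) - 1)) * v⁻¹) := by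
    refine intervalIntegral.integral_mono_on ha1
      (intervalIntegrable_integrand hr hp ha (sub_pos.2 hp)) hI ?_
    intro x hx
    have hx0 : 0 < x := ha.trans_le hx.1
    have hx1 : x ≤ 1 := hx.2.trans (by linarith)
    have hle : branchRate r p x ≤ ((r : ℝ) - 1) * x := by
      unfold branchRate
      have e1 : x ^ (r - 2) ≤ x := by
        calc x ^ (r - 2) ≤ x ^ 1 := pow_le_pow_of_le_one hx0.le hx1 (by omega)
          _ = x := pow_one x
      have e2 : 0 ≤ x ^ (r - 2) := by positivity
      calc ((r : ℝ) - 1) * (1 - p) * x ^ (r - 2) ≤ ((r : ℝ) - 1) * 1 * x := by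
            gcongr <;> linarith
        _ = _ := by ring
    have := one_div_le_one_div_of_le (branchRate_pos hr hp hx0) hle
    rw [one_div_mul_eq_div, inv_eq_one_div, div_div, mul_comm x]
    linarith
  have hJ : IntervalIntegrable (fun v : ℝ => (1 / ((r : ℝ) - 1)) * v⁻¹) volume a (1 - p) := by
    refine ContinuousOn.intervalIntegrable ?_
    refine (continuousOn_const.mul (continuousOn_id.inv₀ ?_))
    intro x hx
    exact (lt_of_lt_of_le (lt_min ha (sub_pos.2 hp)) hx.1).ne'
  have e : ∫ v in a..(1 - p), (1 - (1 / ((r : ℝ) - 1)) * v⁻¹)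
      = (1 - p - a) - (1 / ((r : ℝ) - 1)) * Real.log ((1 - p) / a) := by
    rw [intervalIntegral.integral_sub (by simp) hJ, intervalIntegral.integral_const_mul,
      integral_inv_of_pos ha (sub_pos.2 hp)]
    simp
  rw [e] at h
  unfold blueMass
  linarith

/-- `α` is the silence probability at which the process stops. -/
structure IsStop (r : ℕ) (p α : ℝ) : Prop where
  pos : 0 < α
  lt : α < 1 - p
  rate_lt : branchRate r p α < 1
  zero : blueMass r p α = 0
  mass_pos : ∀ a, α < a → a ≤ 1 - p → 0 < blueMass r p a

/-- The stopping point is the largest point at which the blue mass is nonpositive. If $K$ were at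
least $1$ there, the integrand would be nonnegative on all of $[\alpha,1-p]$ and the blue mass at
least $p$. -/
lemma exists_isStop (hr : 3 ≤ r) (hp0 : 0 < p) (hp : p < 1) : ∃ α, IsStop r p α := by
  have h3 : (3 : ℝ) ≤ r := by exact_mod_cast hr
  have hq : 0 < 1 - p := sub_pos.2 hp
  -- At this point the logarithm equals $r$, and $r/(r-1)\ge1$.
  set e : ℝ := (1 - p) * Real.exp (-r) with he
  have he0 : 0 < e := by positivity
  have he1 : e ≤ 1 - p := by
    have : Real.exp (-r) ≤ 1 := Real.exp_le_one_iff.2 (by linarith)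
    nlinarith
  have hneg : blueMass r p e ≤ 0 := by
    have h := blueMass_le_log hr hp0 hp he0 he1
    have : (1 - p) / e = Real.exp r := by
      rw [he, Real.exp_neg]; field_simp
    rw [this, Real.log_exp] at h
    have : 1 ≤ 1 / ((r : ℝ) - 1) * r := by
      rw [one_div_mul_eq_div, le_div_iff₀ (by linarith)]; linarith
    linarith
  have hcont : ContinuousOn (blueMass r p) (Set.Ioi 0) := fun x hx =>
    (hasDerivAt_blueMass hr hp hx).continuousAt.continuousWithinAt
  set S := Set.Icc e (1 - p) ∩ blueMass r p ⁻¹' Set.Iic 0 with hS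
  have hSc : IsCompact S := by
    refine isCompact_Icc.of_isClosed_subset ?_ Set.inter_subset_left
    exact (hcont.mono fun x hx => he0.trans_le hx.1).preimage_isClosed_of_isClosed isClosed_Icc
      isClosed_Iic
  obtain ⟨α, hα, hmax⟩ := hSc.exists_isGreatest ⟨e, ⟨le_rfl, he1⟩, hneg⟩
  have hα0 : 0 < α := he0.trans_le hα.1.1
  have hle : blueMass r p α ≤ 0 := hα.2
  have hlt : α < 1 - p := by
    refine lt_of_le_of_ne hα.1.2 ?_
    rintro rfl
    rw [blueMass_one_sub] at hle
    linarith
  have hpos : ∀ a, α < a → a ≤ 1 - p → 0 < blueMass r p a := by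
    intro a h1 h2
    by_contra h
    exact absurd (hmax ⟨⟨hα.1.1.trans h1.le, h2⟩, not_lt.1 h⟩) (not_le.2 h1)
  refine ⟨α, hα0, hlt, ?_, ?_, hpos⟩
  · by_contra hK
    push Not at hK
    have : 0 ≤ ∫ v in α..(1 - p), (1 - 1 / branchRate r p v) := by
      refine intervalIntegral.integral_nonneg hlt.le ?_
      intro x hx
      have h1 : 1 ≤ branchRate r p x := hK.trans (branchRate_mono hr hp hα0.le hx.1)
      have : 1 / branchRate r p x ≤ 1 := by
        rw [div_le_one (by linarith)]; exact h1
      linarith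
    unfold blueMass at hle
    linarith
  · refine le_antisymm hle ?_
    have ht : Tendsto (blueMass r p) (𝓝[>] α) (𝓝 (blueMass r p α)) :=
      (hasDerivAt_blueMass hr hp hα0).continuousAt.tendsto.mono_left nhdsWithin_le_nhds
    refine ge_of_tendsto ht ?_
    filter_upwards [Ioo_mem_nhdsGT hlt] with x hx
    exact (hpos x hx.1 hx.2.le).le

/-- By concavity the graph lies below its tangent at $\alpha$, whose slope $1/K(\alpha)-1$ is
positive; so the blue mass is negative to the left of $\alpha$. -/
lemma IsStop.le_of_blueMass_nonneg {α β : ℝ} (h : IsStop r p α) (hr : 3 ≤ r) (hp : p < 1)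
    (hβ : 0 < β) (hm : 0 ≤ blueMass r p β) : α ≤ β := by
  by_contra hlt
  push Not at hlt
  have h1 := blueMass_le_tangent hr hp hβ hlt.le
  rw [h.zero] at h1
  have h2 : 1 < 1 / branchRate r p α := by
    rw [lt_div_iff₀ (branchRate_pos hr hp h.pos)]; linarith [h.rate_lt]
  nlinarith

/-- The derivative is $-\frac{r}{r-1}x(1-K(x))$. Hence stopping too early in the subcritical range
only loses, and upper bounds for $\alpha$ become lower bounds for $\xi$. -/
lemma forestGain_anti (hr : 3 ≤ r) (hp : p < 1) {a β : ℝ} (ha : 0 < a) (hab : a ≤ β)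
    (hβ : branchRate r p β ≤ 1) : forestGain r p β ≤ forestGain r p a := by
  have h3 : (3 : ℝ) ≤ r := by exact_mod_cast hr
  have hd : ∀ x : ℝ, HasDerivAt (forestGain r p)
      (-(r / ((r : ℝ) - 1) * x * (1 - branchRate r p x))) x := by
    intro x
    have h1 : HasDerivAt (forestGain r p) (r / (2 * ((r : ℝ) - 1)) * (0 - 2 * x ^ (2 - 1) * 1)
        + (1 - p) * (r * x ^ (r - 1) * 1)) x := by
      unfold forestGain
      exact (((hasDerivAt_const x _).sub ((hasDerivAt_id x).pow 2)).const_mul _).add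
        (((hasDerivAt_id x).pow r).const_mul _)
    convert h1 using 1
    unfold branchRate
    obtain ⟨k, rfl⟩ : ∃ k, r = k + 2 := ⟨r - 2, by omega⟩
    have : ((k + 2 : ℕ) : ℝ) - 1 ≠ 0 := by linarith
    simp only [Nat.add_sub_cancel, show k + 2 - 1 = k + 1 by omega]
    field_simp
    ring
  refine antitoneOn_of_deriv_nonpos (convex_Icc a β) (fun x _ => (hd x).continuousAt.continuousWithinAt)
    (fun x _ => (hd x).differentiableAt.differentiableWithinAt) ?_ ⟨le_rfl, hab⟩ ⟨hab, le_rfl⟩ hab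
  intro x hx
  rw [interior_Icc] at hx
  rw [(hd x).deriv]
  have hx0 : 0 < x := ha.trans hx.1
  have h1 : branchRate r p x ≤ 1 := (branchRate_mono hr hp hx0.le hx.2.le).trans hβ
  have h2 : 0 ≤ r / ((r : ℝ) - 1) := div_nonneg (by linarith) (by linarith)
  have : 0 ≤ r / ((r : ℝ) - 1) * x * (1 - branchRate r p x) :=
    mul_nonneg (mul_nonneg h2 hx0.le) (by linarith)
  linarith

end


/-! ### Existence of the solution and the value of $\xi(r,p)$. -/

/-- An autonomous scalar equation with continuous, positive, bounded right-hand side has a global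
solution, which runs through all of `ℝ`. -/
lemma exists_global_flow {H : ℝ → ℝ} (hH : Continuous H) (hpos : ∀ z, 0 < H z) {L : ℝ}
    (hL : ∀ z, H z ≤ L) (z₀ : ℝ) :
    ∃ z : ℝ → ℝ, z 0 = z₀ ∧ Monotone z ∧ Tendsto z atBot atBot ∧
      ∀ x, HasDerivAt z (H (z x)) x := by
  have hLpos : 0 < L := (hpos 0).trans_le (hL 0)
  have hc : Continuous fun v => 1 / H v := continuous_const.div hH fun v => (hpos v).ne'
  set Θ : ℝ → ℝ := fun z => ∫ v in z₀..z, 1 / H v with hΘ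
  have hd : ∀ z, HasDerivAt Θ (1 / H z) z := fun z => hc.integral_hasStrictDerivAt z₀ z |>.hasDerivAt
  have hcont : Continuous Θ := continuous_iff_continuousAt.2 fun z => (hd z).continuousAt
  have hmono : StrictMono Θ := strictMono_of_deriv_pos fun z => by
    rw [(hd z).deriv]; exact one_div_pos.2 (hpos z)
  -- The travel time $\Theta$ grows at rate at least $1/L$, so it is onto; its inverse is the
  -- solution.
  have hgrow : Monotone fun z => Θ z - (1 / L) * z := by
    have hd' : ∀ z, HasDerivAt (fun z => Θ z - (1 / L) * z) (1 / H z - (1 / L) * 1) z := fun z =>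
      (hd z).sub ((hasDerivAt_id z).const_mul (1 / L))
    refine monotone_of_deriv_nonneg (fun z => (hd' z).differentiableAt) fun z => ?_
    rw [(hd' z).deriv]
    have := one_div_le_one_div_of_le (hpos z) (hL z)
    linarith
  have htop : Tendsto Θ atTop atTop := by
    have h1 : Tendsto (fun z : ℝ => (Θ 0 - 1 / L * 0) + 1 / L * z) atTop atTop :=
      tendsto_atTop_add_const_left _ _ (tendsto_id.const_mul_atTop (by positivity))
    refine tendsto_atTop_mono' _ ?_ h1
    filter_upwards [eventually_ge_atTop 0] with z hz
    have := hgrow hz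
    simp only at this
    linarith
  have hbot : Tendsto Θ atBot atBot := by
    have h1 : Tendsto (fun z : ℝ => (Θ 0 - 1 / L * 0) + 1 / L * z) atBot atBot :=
      tendsto_atBot_add_const_left _ _ (tendsto_id.const_mul_atBot (by positivity))
    refine tendsto_atBot_mono' _ ?_ h1
    filter_upwards [eventually_le_atBot 0] with z hz
    have := hgrow hz
    simp only at this
    linarith
  have hsurj : Function.Surjective Θ := hcont.surjective htop hbot
  set e := hmono.orderIsoOfSurjective Θ hsurj with he
  have heΘ : ∀ z, e z = Θ z := fun z => rfl
  refine ⟨e.symm, ?_, e.symm.monotone, e.symm.tendsto_atBot, fun x => ?_⟩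
  · rw [OrderIso.symm_apply_eq, heΘ]; simp [hΘ]
  · have := HasDerivAt.of_local_left_inverse (f := Θ) (g := e.symm) (a := x)
      e.symm.continuous.continuousAt (hd (e.symm x)) (one_div_pos.2 (hpos _)).ne'
      (Eventually.of_forall fun y => e.apply_symm_apply y)
    simpa using this

section

variable {r : ℕ} {p α : ℝ}

/-- The blue mass vanishes at most linearly at $\alpha$, so that $\alpha$ is not reached in finite
time. -/
lemma IsStop.blueMass_le (h : IsStop r p α) (hr : 3 ≤ r) (hp : p < 1) {a : ℝ} (ha : α ≤ a) :
    blueMass r p a ≤ (a - α) / branchRate r p α := by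
  have h1 := blueMass_sub hr hp h.pos (h.pos.trans_le ha)
  rw [h.zero] at h1
  have h2 : ∫ v in α..a, (1 - 1 / branchRate r p α) ≤ ∫ v in α..a, (1 - 1 / branchRate r p v) := by
    refine intervalIntegral.integral_mono_on ha (by simp)
      (intervalIntegrable_integrand hr hp h.pos (h.pos.trans_le ha)) ?_
    intro x hx
    have := one_div_le_one_div_of_le (branchRate_pos hr hp h.pos)
      (branchRate_mono hr hp h.pos.le hx.1)
    linarith
  rw [intervalIntegral.integral_const, smul_eq_mul] at h2
  have h3 : (a - α) / branchRate r p α = (a - α) * (1 / branchRate r p α) := by ring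
  rw [h3]
  nlinarith

/-- The silence probability as a function of time. -/
lemma IsStop.exists_silence (h : IsStop r p α) (hr : 3 ≤ r) (hp : p < 1) :
    ∃ a : ℝ → ℝ, a 0 = 1 - p ∧ Tendsto a atTop (𝓝 α) ∧ ∀ x, 0 ≤ x → α < a x ∧ a x ≤ 1 - p ∧
      HasDerivAt a (-(branchRate r p (a x) * blueMass r p (a x))) x := by
  have hq : 0 < 1 - p := sub_pos.2 hp
  have hqα : 0 < 1 - p - α := sub_pos.2 h.lt
  set m : ℝ → ℝ := fun z => min (α + Real.exp z) (1 - p) with hm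
  have hmα : ∀ z, α < m z := fun z => lt_min (by linarith [Real.exp_pos z]) h.lt
  have hmq : ∀ z, m z ≤ 1 - p := fun z => min_le_right _ _
  have hmc : Continuous m := by fun_prop
  -- In the coordinate $z=\log(a-\alpha)$ with time reversed, the equation for $a$ becomes
  -- $z'=H(z)$, with $H$ positive and bounded. The truncation in `m` keeps the argument where the
  -- blue mass is known to be positive and is inactive along the trajectory for $x\ge0$.
  set H : ℝ → ℝ := fun z => branchRate r p (m z) * blueMass r p (m z) / Real.exp z with hH
  have hKpos := branchRate_pos hr hp h.pos
  have hHc : Continuous H := by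
    refine ((continuous_branchRate.comp hmc).mul ?_).div Real.continuous_exp
      fun z => (Real.exp_pos z).ne'
    refine continuous_iff_continuousAt.2 fun z => ?_
    exact ContinuousAt.comp (g := blueMass r p) (hasDerivAt_blueMass hr hp (h.pos.trans (hmα z))).continuousAt
      hmc.continuousAt
  have hHpos : ∀ z, 0 < H z := fun z => div_pos (mul_pos (branchRate_pos hr hp (h.pos.trans (hmα z)))
    (h.mass_pos _ (hmα z) (hmq z))) (Real.exp_pos z)
  have hHL : ∀ z, H z ≤ branchRate r p (1 - p) / branchRate r p α := by
    intro z
    have hz := Real.exp_pos z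
    rw [hH, div_le_iff₀ hz]
    have h1 : branchRate r p (m z) ≤ branchRate r p (1 - p) :=
      branchRate_mono hr hp (h.pos.trans (hmα z)).le (hmq z)
    have h2 : blueMass r p (m z) ≤ Real.exp z / branchRate r p α := by
      refine (h.blueMass_le hr hp (hmα z).le).trans ?_
      gcongr
      have : m z ≤ α + Real.exp z := min_le_left _ _
      linarith
    calc branchRate r p (m z) * blueMass r p (m z)
        ≤ branchRate r p (1 - p) * (Real.exp z / branchRate r p α) :=
          mul_le_mul h1 h2 (h.mass_pos _ (hmα z) (hmq z)).le (branchRate_pos hr hp hq).le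
      _ = _ := by ring
  obtain ⟨z, hz0, hzm, hzb, hzd⟩ := exists_global_flow hHc hHpos hHL (Real.log (1 - p - α))
  refine ⟨fun x => α + Real.exp (z (-x)), ?_, ?_, fun x hx => ?_⟩
  · simp [hz0, Real.exp_log hqα]
  · have : Tendsto (fun x => Real.exp (z (-x))) atTop (𝓝 0) :=
      Real.tendsto_exp_atBot.comp (hzb.comp tendsto_neg_atTop_atBot)
    simpa using this.const_add α
  · have hle : α + Real.exp (z (-x)) ≤ 1 - p := by
      have h1 : z (-x) ≤ Real.log (1 - p - α) := hz0 ▸ hzm (by linarith : -x ≤ 0)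
      have h2 := Real.exp_le_exp.2 h1
      rw [Real.exp_log hqα] at h2
      linarith
    refine ⟨by linarith [Real.exp_pos (z (-x))], hle, ?_⟩
    have hd : HasDerivAt (fun x => z (-x)) (H (z (-x)) * (-1)) x :=
      (hzd (-x)).comp x (hasDerivAt_neg x)
    refine (hd.exp.const_add α).congr_deriv ?_
    have : m (z (-x)) = α + Real.exp (z (-x)) := min_eq_left hle
    change Real.exp (z (-x)) * (branchRate r p (m (z (-x))) * blueMass r p (m (z (-x)))
        / Real.exp (z (-x)) * (-1))
      = -(branchRate r p (α + Real.exp (z (-x))) * blueMass r p (α + Real.exp (z (-x))))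
    rw [this]
    field_simp

/-- The value of `ξ(r, p)`. -/
lemma IsStop.isXi (h : IsStop r p α) (hr : 3 ≤ r) (hp0 : 0 < p) (hp : p < 1) :
    IsXi r p (p * (1 - p) ^ r + forestGain r p α) := by
  obtain ⟨a, ha0, hlim, ha⟩ := h.exists_silence hr hp
  have hq : 0 < 1 - p := sub_pos.2 hp
  have hr3 : (3 : ℝ) ≤ r := by exact_mod_cast hr
  have hr1 : 0 < (r : ℝ) - 1 := by linarith
  obtain ⟨k, rfl⟩ : ∃ k, r = k + 3 := ⟨r - 3, by omega⟩
  set K : ℝ → ℝ := fun x => branchRate (k + 3) p (a x) with hK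
  set y : ℝ → ℝ := fun x => blueMass (k + 3) p (a x) with hy
  have hapos : ∀ x, 0 ≤ x → 0 < a x := fun x hx => h.pos.trans (ha x hx).1
  have hKpos : ∀ x, 0 ≤ x → 0 < K x := fun x hx => branchRate_pos hr hp (hapos x hx)
  have hypos : ∀ x, 0 ≤ x → 0 < y x := fun x hx => h.mass_pos _ (ha x hx).1 (ha x hx).2.1
  have had : ∀ x, 0 ≤ x → HasDerivAt a (-(K x * y x)) x := fun x hx => (ha x hx).2.2
  have hKe : ∀ x, K x = (k + 2) * (1 - p) * a x ^ (k + 1) := fun x => by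
    simp only [hK, branchRate, show k + 3 - 2 = k + 1 by omega]
    push_cast
    ring
  have hyd : ∀ x, 0 ≤ x → HasDerivAt y ((K x - 1) * y x) x := by
    intro x hx
    refine ((hasDerivAt_blueMass hr hp (hapos x hx)).comp x (had x hx)).congr_deriv ?_
    have := (hKpos x hx).ne'
    change -(1 - 1 / K x) * -(K x * y x) = _
    field_simp
  have hpowd : ∀ (j : ℕ) x, 0 ≤ x → HasDerivAt (fun x => a x ^ (j + 1))
      (((j : ℝ) + 1) * a x ^ j * -(K x * y x)) x := by
    intro j x hx
    refine ((had x hx).pow (j + 1)).congr_deriv ?_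
    simp
  have hcd : ∀ x, 0 ≤ x → HasDerivAt (fun x => (k + 2) * (1 - p) * a x ^ (k + 1) * y x)
      ((k + 2) * (1 - p) * (((k : ℝ) + 1) * a x ^ k * -(K x * y x)) * y x +
        (k + 2) * (1 - p) * a x ^ (k + 1) * ((K x - 1) * y x)) x := fun x hx =>
    ((hpowd k x hx).const_mul _).mul (hyd x hx)
  have hy0 : y 0 = p := by simp only [hy, ha0, blueMass_one_sub]
  -- An antiderivative of $b$: by $a'=-Ky$ one has $r(1-p)a^{r-1}y=-\frac{r}{r-1}aa'$.
  have hbd : ∀ x, 0 ≤ x → HasDerivAt (fun x => -((k + 3) / (2 * (k + 2)) * a x ^ 2))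
      ((k + 3) * (1 - p) * a x ^ (k + 2) * y x) x := by
    intro x hx
    refine (((hpowd 1 x hx).const_mul ((k + 3 : ℝ) / (2 * (k + 2)))).neg).congr_deriv ?_
    rw [hKe]
    field_simp
    push_cast
    ring
  have hblim : Tendsto (fun x => -(((k : ℝ) + 3) / (2 * (k + 2)) * a x ^ 2)) atTop
      (𝓝 (-((k + 3) / (2 * (k + 2)) * α ^ 2))) := ((hlim.pow 2).const_mul _).neg
  have hbnn : ∀ x ∈ Set.Ioi (0 : ℝ), 0 ≤ (k + 3) * (1 - p) * a x ^ (k + 2) * y x := by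
    intro x hx
    have h1 := hapos x (le_of_lt hx)
    have h2 := hypos x (le_of_lt hx)
    positivity
  have hbint := integrableOn_Ioi_deriv_of_nonneg' (fun x hx => hbd x hx) hbnn hblim
  have hbval := integral_Ioi_of_hasDerivAt_of_nonneg' (fun x hx => hbd x hx) hbnn hblim
  have e1 : (k : ℝ) + 3 - 1 = k + 2 := by ring
  have e2 : (k : ℝ) + 3 - 2 = k + 1 := by ring
  -- The product form of the solution; the factor $(k+2)(1-p)a^{k+1}y$ in $s$ and $t$ is $Ky$, and
  -- $(r-1)q/w$ is $K$, with limit $K(\alpha)$.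
  refine ⟨fun x => (1 - p) * a x ^ (k + 3), fun x => (k + 3) * (1 - p) * a x ^ (k + 2) * y x,
    fun x => (1 - p) ^ 2 * a x ^ (2 * k + 4),
    fun x => (1 - p) * a x ^ (k + 2) * ((k + 2) * (1 - p) * a x ^ (k + 1) * y x),
    fun x => ((k + 2) * (1 - p) * a x ^ (k + 1) * y x) ^ 2,
    (1 - p) * α ^ (k + 3), branchRate (k + 3) p α, ?_, hbint, ?_, ?_, ?_⟩
  · constructor
    · intro x hx; have := hapos x hx; positivity
    · intro x hx; have := hapos x hx; have := hypos x hx; positivity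
    · intro x hx; have := hapos x hx; positivity
    · intro x hx; have := hapos x hx; have := hypos x hx; positivity
    · intro x hx; have := hapos x hx; have := hypos x hx; positivity
    · simp only [ha0]; ring
    · simp only [ha0, hy0]; push_cast; ring
    · simp only [ha0]; ring
    · simp only [ha0, hy0, show 2 * (k + 3) - 1 = 2 * k + 5 by omega]; push_cast; ring
    · simp only [ha0, hy0, show 2 * (k + 3) - 2 = 2 * k + 4 by omega]; push_cast; ring
    · intro x hx
      refine HasDerivAt.hasDerivWithinAt (((hpowd (k + 2) x hx).const_mul (1 - p)).congr_deriv ?_)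
      rw [hKe]; push_cast; ring
    · intro x hx
      refine HasDerivAt.hasDerivWithinAt ((((hpowd (k + 1) x hx).const_mul
        ((k + 3 : ℝ) * (1 - p))).mul (hyd x hx)).congr_deriv ?_)
      rw [hKe]; push_cast; ring
    · intro x hx
      have := (hapos x hx).ne'
      refine HasDerivAt.hasDerivWithinAt (((hpowd (2 * k + 3) x hx).const_mul
        ((1 - p) ^ 2)).congr_deriv ?_)
      rw [hKe]; push_cast; field_simp; ring
    · intro x hx
      have := (hapos x hx).ne'
      have := (hypos x hx).ne'
      refine HasDerivAt.hasDerivWithinAt ((((hpowd (k + 1) x hx).const_mul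
        (1 - p)).mul (hcd x hx)).congr_deriv ?_)
      rw [hKe]; push_cast; rw [e1, e2]; field_simp; ring
    · intro x hx
      have := (hapos x hx).ne'
      have := (hypos x hx).ne'
      refine HasDerivAt.hasDerivWithinAt (((hcd x hx).pow 2).congr_deriv ?_)
      rw [hKe]; push_cast; rw [e1, e2]; field_simp; ring
  · exact (hlim.pow _).const_mul _
  · have h1 : Tendsto (fun x => branchRate (k + 3) p (a x)) atTop (𝓝 (branchRate (k + 3) p α)) :=
      (continuous_branchRate.tendsto α).comp hlim
    refine h1.congr' ?_
    filter_upwards [eventually_ge_atTop 0] with x hx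
    have := (hapos x hx).ne'
    change K x = _
    rw [hKe]
    push_cast
    field_simp
    ring
  · rw [if_pos h.rate_lt, hbval, ha0]
    unfold forestGain
    push_cast
    rw [e1]
    ring

end


/-! ### Uniqueness of the solution and of $\xi(r,p)$. -/

/-- The right-hand side of the system. -/
def vectorField (r : ℕ) (z : ℝ × ℝ × ℝ × ℝ × ℝ) : ℝ × ℝ × ℝ × ℝ × ℝ :=
  (-(r * z.2.2.2.1),
   -z.2.1 - r * z.2.2.2.2 + r * z.2.2.2.1,
   -((2 * (r : ℝ) - 2) * z.2.2.1 * z.2.2.2.1 / z.1),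
   -z.2.2.2.1 + ((r : ℝ) - 1) * z.2.2.1 * z.2.2.2.1 / z.1 - ((r : ℝ) - 1) * z.2.2.2.1 ^ 2 / z.1
        - r * ((r : ℝ) - 2) * z.2.2.2.1 * z.2.2.2.2 / (((r : ℝ) - 1) * z.2.1),
   -2 * z.2.2.2.2 + 2 * ((r : ℝ) - 1) * z.2.2.2.1 ^ 2 / z.1
        - 2 * r * ((r : ℝ) - 2) * z.2.2.2.2 ^ 2 / (((r : ℝ) - 1) * z.2.1))

/-- The part of phase space in which the vector field is smooth. -/
def phaseSpace : Set (ℝ × ℝ × ℝ × ℝ × ℝ) := Set.Ioi 0 ×ˢ Set.Ioi 0 ×ˢ Set.univ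

lemma locallyLipschitzOn_vectorField {r : ℕ} (hr : 3 ≤ r) :
    LocallyLipschitzOn phaseSpace (vectorField r) := by
  have hr3 : (3 : ℝ) ≤ r := by exact_mod_cast hr
  have hr1 : (r : ℝ) - 1 ≠ 0 := by linarith
  have hconv : Convex ℝ phaseSpace :=
    (convex_Ioi (0 : ℝ)).prod ((convex_Ioi (0 : ℝ)).prod convex_univ)
  refine ContDiffOn.locallyLipschitzOn hconv ?_
  have h1 : ∀ z ∈ phaseSpace, z.1 ≠ 0 := fun z hz => (Set.mem_Ioi.1 hz.1).ne'
  have h2 : ∀ z ∈ phaseSpace, ((r : ℝ) - 1) * z.2.1 ≠ 0 := fun z hz =>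
    mul_ne_zero hr1 (Set.mem_Ioi.1 hz.2.1).ne'
  unfold vectorField
  fun_prop (disch := assumption)

/-- Positivity of $w$ and $b$ keeps both solutions where the field is smooth. Up to time $x$ their
trajectories form a compact set, on which a single Lipschitz constant serves. -/
lemma IsSolution.unique {r : ℕ} (hr : 3 ≤ r) {p : ℝ} {w b q s t w' b' q' s' t' : ℝ → ℝ}
    (h : IsSolution r p w b q s t) (h' : IsSolution r p w' b' q' s' t') {x : ℝ} (hx : 0 ≤ x) :
    w x = w' x ∧ b x = b' x ∧ q x = q' x := by
  have key : ∀ {w b q s t : ℝ → ℝ}, IsSolution r p w b q s t →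
      (∀ y, 0 ≤ y → HasDerivWithinAt (fun y => (w y, b y, q y, s y, t y))
        (vectorField r (w y, b y, q y, s y, t y)) (Set.Ici 0) y) ∧
      (∀ y, 0 ≤ y → (w y, b y, q y, s y, t y) ∈ phaseSpace) := by
    intro w b q s t h
    refine ⟨fun y hy => ?_, fun y hy => ⟨h.w_pos y hy, h.b_pos y hy, trivial⟩⟩
    exact (h.w_deriv y hy).prodMk ((h.b_deriv y hy).prodMk ((h.q_deriv y hy).prodMk
      ((h.s_deriv y hy).prodMk (h.t_deriv y hy))))
  obtain ⟨hd, hm⟩ := key h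
  obtain ⟨hd', hm'⟩ := key h'
  set f : ℝ → ℝ × ℝ × ℝ × ℝ × ℝ := fun y => (w y, b y, q y, s y, t y) with hf
  set g : ℝ → ℝ × ℝ × ℝ × ℝ × ℝ := fun y => (w' y, b' y, q' y, s' y, t' y) with hg
  have hsub : Set.Icc 0 x ⊆ Set.Ici (0 : ℝ) := fun y hy => hy.1
  have hfc : ContinuousOn f (Set.Icc 0 x) := fun y hy =>
    (hd y hy.1).continuousWithinAt.mono hsub
  have hgc : ContinuousOn g (Set.Icc 0 x) := fun y hy =>
    (hd' y hy.1).continuousWithinAt.mono hsub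
  have hcomp : IsCompact (f '' Set.Icc 0 x ∪ g '' Set.Icc 0 x) :=
    (isCompact_Icc.image_of_continuousOn hfc).union (isCompact_Icc.image_of_continuousOn hgc)
  have hps : f '' Set.Icc 0 x ∪ g '' Set.Icc 0 x ⊆ phaseSpace := by
    rintro z (⟨y, hy, rfl⟩ | ⟨y, hy, rfl⟩)
    · exact hm y hy.1
    · exact hm' y hy.1
  obtain ⟨L, hL⟩ := LocallyLipschitzOn.exists_lipschitzOnWith_of_compact hcomp
    ((locallyLipschitzOn_vectorField hr).mono hps)
  have heq : f 0 = g 0 := by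
    simp only [hf, hg, h.w_zero, h'.w_zero, h.b_zero, h'.b_zero, h.q_zero, h'.q_zero, h.s_zero,
      h'.s_zero, h.t_zero, h'.t_zero]
  have := ODE_solution_unique_of_mem_Icc_right (v := fun _ => vectorField r)
    (s := fun _ => f '' Set.Icc 0 x ∪ g '' Set.Icc 0 x) (a := 0) (b := x) (fun _ _ => hL) hfc
    (fun y hy => (hd y hy.1).mono (Set.Ici_subset_Ici.2 hy.1))
    (fun y hy => Or.inl ⟨y, ⟨hy.1, hy.2.le⟩, rfl⟩) hgc
    (fun y hy => (hd' y hy.1).mono (Set.Ici_subset_Ici.2 hy.1))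
    (fun y hy => Or.inr ⟨y, ⟨hy.1, hy.2.le⟩, rfl⟩) heq
  have hfg : f x = g x := this ⟨hx, le_rfl⟩
  simp only [hf, hg, Prod.mk.injEq] at hfg
  exact ⟨hfg.1, hfg.2.1, hfg.2.2.1⟩

lemma IsXi.unique {r : ℕ} (hr : 3 ≤ r) {p v v' : ℝ} (h : IsXi r p v) (h' : IsXi r p v') :
    v = v' := by
  obtain ⟨w, b, q, s, t, l, ρ, hs, -, hw, hρ, rfl⟩ := h
  obtain ⟨w', b', q', s', t', l', ρ', hs', -, hw', hρ', rfl⟩ := h'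
  have hl : l = l' := by
    refine tendsto_nhds_unique hw (hw'.congr' ?_)
    filter_upwards [eventually_ge_atTop 0] with x hx
    exact (hs.unique hr hs' hx).1.symm
  have hρρ : ρ = ρ' := by
    refine tendsto_nhds_unique hρ (hρ'.congr' ?_)
    filter_upwards [eventually_ge_atTop 0] with x hx
    rw [(hs.unique hr hs' hx).1, (hs.unique hr hs' hx).2.2]
  have hb : ∫ x in Set.Ioi (0 : ℝ), b x = ∫ x in Set.Ioi (0 : ℝ), b' x :=
    setIntegral_congr_fun measurableSet_Ioi fun x hx => (hs.unique hr hs' (le_of_lt hx)).2.1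
  rw [hl, hρρ, hb]

/-! ### The supremum $\xi(r)$ and closed forms of the blue mass. -/

section

variable {r : ℕ}

lemma mem_xiValues_iff (hr : 3 ≤ r) {v : ℝ} : v ∈ xiValues r ↔
    ∃ p α, 0 < p ∧ p < 1 ∧ IsStop r p α ∧ v = p * (1 - p) ^ r + forestGain r p α := by
  constructor
  · rintro ⟨p, ⟨hp0, hp⟩, h⟩
    obtain ⟨α, hα⟩ := exists_isStop hr hp0 hp
    exact ⟨p, α, hp0, hp, hα, h.unique hr (hα.isXi hr hp0 hp)⟩
  · rintro ⟨p, α, hp0, hp, hα, rfl⟩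
    exact ⟨p, ⟨hp0, hp⟩, hα.isXi hr hp0 hp⟩

lemma existsUnique_isXi (hr : 3 ≤ r) {p : ℝ} (hp : p ∈ Set.Ioo (0 : ℝ) 1) : ∃! v, IsXi r p v := by
  obtain ⟨α, hα⟩ := exists_isStop hr hp.1 hp.2
  exact ⟨_, hα.isXi hr hp.1 hp.2, fun v hv => hv.unique hr (hα.isXi hr hp.1 hp.2)⟩

/-- Each of the three summands is at most $1$. The crude bound gives finiteness of the supremum and
caps the loss at a bad vertex. -/
lemma IsStop.value_le_three {p α : ℝ} (hα : IsStop r p α) (hr : 3 ≤ r) (hp0 : 0 < p) (hp : p < 1) :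
    p * (1 - p) ^ r + forestGain r p α ≤ 3 := by
  have hr3 : (3 : ℝ) ≤ r := by exact_mod_cast hr
  have hα1 : α ≤ 1 := by linarith [hα.lt]
  have e1 : (1 - p) ^ r ≤ 1 := pow_le_one₀ (by linarith) (by linarith)
  have e2 : α ^ r ≤ 1 := pow_le_one₀ hα.pos.le hα1
  have e3 : 0 ≤ (1 - p) ^ r := pow_nonneg (by linarith) _
  have e4 : 0 ≤ α ^ r := pow_nonneg hα.pos.le _
  have e5 : r / (2 * ((r : ℝ) - 1)) ≤ 1 := by rw [div_le_one (by linarith)]; linarith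
  have e6 : 0 ≤ r / (2 * ((r : ℝ) - 1)) := div_nonneg (by linarith) (by linarith)
  have e7 : (1 - p) ^ 2 - α ^ 2 ≤ 1 := by nlinarith
  have f1 : p * (1 - p) ^ r ≤ 1 := by nlinarith
  have f2 : (1 - p) * α ^ r ≤ 1 := by nlinarith
  have f3 : r / (2 * ((r : ℝ) - 1)) * ((1 - p) ^ 2 - α ^ 2) ≤ 1 := by nlinarith
  unfold forestGain
  linarith

lemma isLUB_xi (hr : 3 ≤ r) : IsLUB (xiValues r) (xi r) := by
  refine isLUB_csSup ?_ ⟨3, ?_⟩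
  · obtain ⟨α, hα⟩ := exists_isStop (r := r) (p := 1 / 2) hr (by norm_num) (by norm_num)
    exact ⟨_, (mem_xiValues_iff hr).2 ⟨1 / 2, α, by norm_num, by norm_num, hα, rfl⟩⟩
  · intro v hv
    obtain ⟨p, α, hp0, hp, hα, rfl⟩ := (mem_xiValues_iff hr).1 hv
    exact hα.value_le_three hr hp0 hp

/-- A lower bound for `ξ(r)` from a value of the silence probability that the process reaches. -/
lemma le_xi (hr : 3 ≤ r) {p β : ℝ} (hp0 : 0 < p) (hp : p < 1) (hβ : 0 < β)
    (hm : 0 ≤ blueMass r p β) (hK : branchRate r p β ≤ 1) :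
    p * (1 - p) ^ r + forestGain r p β ≤ xi r := by
  obtain ⟨α, hα⟩ := exists_isStop hr hp0 hp
  have h1 := (isLUB_xi hr).1 ((mem_xiValues_iff hr).2 ⟨p, α, hp0, hp, hα, rfl⟩)
  have h2 := forestGain_anti hr hp hα.pos (hα.le_of_blueMass_nonneg hr hp hβ hm) hK
  linarith

/-- The blue mass in closed form for `r = k + 4`. -/
lemma blueMass_eq (k : ℕ) {p a : ℝ} (hp : p < 1) (ha : 0 < a) :
    blueMass (k + 4) p a = 1 - a -
      (1 / a ^ (k + 1) - 1 / (1 - p) ^ (k + 1)) / ((k + 1) * (k + 3) * (1 - p)) := by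
  have hq : 0 < 1 - p := sub_pos.2 hp
  have hd : ∀ x ∈ Set.uIcc a (1 - p), HasDerivAt
      (fun x : ℝ => x + (1 / x ^ (k + 1)) / ((k + 1) * (k + 3) * (1 - p)))
      (1 - 1 / branchRate (k + 4) p x) x := by
    intro x hx
    have hx0 : 0 < x := lt_of_lt_of_le (lt_min ha hq) hx.1
    have h1 : HasDerivAt (fun x : ℝ => 1 / x ^ (k + 1))
        ((0 * x ^ (k + 1) - 1 * ((k + 1 : ℕ) * x ^ (k + 1 - 1) * 1)) / (x ^ (k + 1)) ^ 2) x :=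
      (hasDerivAt_const x (1 : ℝ)).fun_div ((hasDerivAt_id x).fun_pow (k + 1)) (by positivity)
    refine ((hasDerivAt_id x).fun_add (h1.div_const _)).congr_deriv ?_
    unfold branchRate
    rw [show k + 4 - 2 = k + 2 by omega, show k + 1 - 1 = k by omega]
    push_cast
    rw [show (k : ℝ) + 4 - 1 = k + 3 by ring]
    field_simp
    ring
  unfold blueMass
  rw [intervalIntegral.integral_eq_sub_of_hasDerivAt hd
    (intervalIntegrable_integrand (by omega) hp ha hq)]
  ring

lemma blueMass_three {p a : ℝ} (hp : p < 1) (ha : 0 < a) :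
    blueMass 3 p a = 1 - a - Real.log ((1 - p) / a) / (2 * (1 - p)) := by
  have hq : 0 < 1 - p := sub_pos.2 hp
  have hd : ∀ x ∈ Set.uIcc a (1 - p), HasDerivAt (fun x : ℝ => x - Real.log x / (2 * (1 - p)))
      (1 - 1 / branchRate 3 p x) x := by
    intro x hx
    have hx0 : 0 < x := lt_of_lt_of_le (lt_min ha hq) hx.1
    refine ((hasDerivAt_id x).fun_sub ((Real.hasDerivAt_log hx0.ne').div_const _)).congr_deriv ?_
    unfold branchRate
    norm_num
    field_simp
  unfold blueMass
  rw [intervalIntegral.integral_eq_sub_of_hasDerivAt hd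
    (intervalIntegrable_integrand le_rfl hp ha hq), Real.log_div hq.ne' ha.ne']
  ring

end


/-! ### Numerical lower bounds. -/

/-- At $p=1/10000$ the closed form of the blue mass reduces everything to rational inequalities in
$\beta$. The values of $\beta$ used below are decimals at or just above the stopping point. -/
lemma table_le_xi {r : ℕ} (k : ℕ) (hk : r = k + 4) {T β : ℝ} (hβ : 0 < β)
    (hm : (1 / β ^ (k + 1) - 1 / (1 - 1 / 10000) ^ (k + 1)) ≤
      (1 - β) * ((k + 1) * (k + 3) * (1 - 1 / 10000)))
    (hK : ((k : ℝ) + 3) * (1 - 1 / 10000) * β ^ (k + 2) ≤ 1)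
    (hT : T ≤ 1 / 10000 * (1 - 1 / 10000) ^ (k + 4) + (((k : ℝ) + 4) / (2 * (k + 3))
      * ((1 - 1 / 10000) ^ 2 - β ^ 2) + (1 - 1 / 10000) * β ^ (k + 4))) : T ≤ xi r := by
  subst hk
  refine hT.trans ?_
  have h := le_xi (r := k + 4) (p := 1 / 10000) (β := β) (by omega) (by norm_num) (by norm_num) hβ
    (by
      rw [blueMass_eq k (by norm_num) hβ, sub_nonneg, div_le_iff₀ (by positivity)]
      exact hm)
    (by
      unfold branchRate
      rw [show k + 4 - 2 = k + 2 by omega]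
      push_cast
      rwa [show (k : ℝ) + 4 - 1 = k + 3 by ring])
  unfold forestGain at h
  push_cast at h
  rwa [show (k : ℝ) + 4 - 1 = k + 3 by ring] at h

lemma xiTable_three_le : xiTable 3 ≤ xi 3 := by
  have h := le_xi (r := 3) (p := 1 / 10000) (β := 204 / 1000) le_rfl (by norm_num) (by norm_num)
    (by norm_num)
    (by
      rw [blueMass_three (by norm_num) (by norm_num), sub_nonneg, div_le_iff₀ (by norm_num),
        Real.log_le_iff_le_exp (by norm_num)]
      -- For $r=3$ the blue mass contains a logarithm; a partial sum of the exponential series turns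
      -- the inequality into a rational one.
      refine le_trans ?_ (Real.sum_le_exp_of_nonneg (by norm_num) 11)
      norm_num [Finset.sum_range_succ, Nat.factorial])
    (by unfold branchRate; norm_num)
  refine le_trans ?_ h
  unfold forestGain xiTable
  norm_num

lemma xiTable_le_xi {r : ℕ} (hr : 3 ≤ r) (hr' : r ≤ 10) : xiTable r ≤ xi r := by
  interval_cases r
  · exact xiTable_three_le
  · exact table_le_xi 0 rfl (β := 3336 / 10000) (by norm_num) (by norm_num) (by norm_num)
      (by norm_num [xiTable])
  · exact table_le_xi 1 rfl (β := 4218 / 10000) (by norm_num) (by norm_num) (by norm_num)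
      (by norm_num [xiTable])
  · exact table_le_xi 2 rfl (β := 4863 / 10000) (by norm_num) (by norm_num) (by norm_num)
      (by norm_num [xiTable])
  · exact table_le_xi 3 rfl (β := 5359 / 10000) (by norm_num) (by norm_num) (by norm_num)
      (by norm_num [xiTable])
  · exact table_le_xi 4 rfl (β := 5755 / 10000) (by norm_num) (by norm_num) (by norm_num)
      (by norm_num [xiTable])
  · exact table_le_xi 5 rfl (β := 6080 / 10000) (by norm_num) (by norm_num) (by norm_num)
      (by norm_num [xiTable])
  · exact table_le_xi 6 rfl (β := 6353 / 10000) (by norm_num) (by norm_num) (by norm_num)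
      (by norm_num [xiTable])


/-! ### The recursion of the discrete process and its limit. -/

/-- The discrete process with time step `η`: the pair of the silence probability and of the blue
mass after `i` rounds. -/
def roundState (r : ℕ) (p η : ℝ) : ℕ → ℝ × ℝ
  | 0 => (1 - p, p)
  | i + 1 =>
    ((roundState r p η i).1 - η * branchRate r p (roundState r p η i).1 * (roundState r p η i).2,
     (1 - η) * (roundState r p η i).2
      + η * branchRate r p (roundState r p η i).1 * (roundState r p η i).2)

/-- The probability that a branch is silent up to round `i`. -/
def silence (r : ℕ) (p η : ℝ) (i : ℕ) : ℝ := (roundState r p η i).1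

/-- The blue mass before round `i + 1`. -/
def pressure (r : ℕ) (p η : ℝ) (i : ℕ) : ℝ := (roundState r p η i).2

/-- The probability that a branch fires in round `i`. -/
def fireProb (r : ℕ) (p η : ℝ) : ℕ → ℝ
  | 0 => p
  | i + 1 => η * branchRate r p (silence r p η i) * pressure r p η i

/-- The law of a vertex label: `0` marks a seed, and otherwise the label is the delay, which is
geometric. -/
def labelProb (p η : ℝ) : ℕ → ℝ
  | 0 => p
  | k + 1 => (1 - p) * η * (1 - η) ^ k

section

variable {r : ℕ} {p η : ℝ}

lemma silence_zero : silence r p η 0 = 1 - p := rfl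

lemma silence_succ (i : ℕ) :
    silence r p η (i + 1) = silence r p η i - fireProb r p η (i + 1) := rfl

lemma pressure_succ (i : ℕ) :
    pressure r p η (i + 1) = (1 - η) * pressure r p η i + fireProb r p η (i + 1) := rfl

lemma silence_eq (i : ℕ) :
    silence r p η i = 1 - ∑ j ∈ Finset.range (i + 1), fireProb r p η j := by
  induction i with
  | zero => simp [silence_zero, fireProb]
  | succ i ih => rw [silence_succ, ih, Finset.sum_range_succ _ (i + 1)]; ring

/-- The geometric delay has no memory: each further round of waiting costs a factor $1-\eta$. Hence
the probability that a branch has fired and the delay of its parent ends exactly in round $i+1$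
obeys the one-step recursion of the pressure. -/
lemma pressure_eq (i : ℕ) : (1 - p) * η * pressure r p η i =
    ∑ j ∈ Finset.range (i + 1), labelProb p η (i + 1 - j) * fireProb r p η j := by
  induction i with
  | zero => simp [labelProb, fireProb, pressure, roundState]
  | succ i ih =>
    rw [pressure_succ, Finset.sum_range_succ, show i + 1 + 1 - (i + 1) = 0 + 1 by omega, mul_add,
      mul_left_comm, ih, Finset.mul_sum]
    simp only [labelProb, pow_zero, mul_one]
    congr 1
    refine Finset.sum_congr rfl fun j hj => ?_
    have hj' : j < i + 1 := Finset.mem_range.1 hj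
    rw [show i + 1 + 1 - j = (i + 1 - j - 1) + 1 + 1 by omega,
      show i + 1 - j = (i + 1 - j - 1) + 1 by omega]
    simp only [Nat.add_sub_cancel]
    ring

/-- The form in which the recursion arises on a tree: one of $r-1$ branches triggers, and the other
$r-2$ are silent. -/
lemma fireProb_succ (i : ℕ) : fireProb r p η (i + 1) =
    ((r : ℝ) - 1) * (∑ j ∈ Finset.range (i + 1), labelProb p η (i + 1 - j) * fireProb r p η j)
      * silence r p η i ^ (r - 2) := by
  rw [← pressure_eq]
  simp only [fireProb, branchRate]
  ring

/-- The discrete process stays in the triangle `a > 0`, `y > 0`, `a + y ≤ 1`. -/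
lemma round_invariant (hr : 3 ≤ r) (hp0 : 0 < p) (hp : p < 1) (hη : 0 < η)
    (hη' : η * ((r : ℝ) - 1) < 1) (i : ℕ) :
    0 < silence r p η i ∧ silence r p η i ≤ 1 - p ∧ 0 < pressure r p η i ∧
      silence r p η i + pressure r p η i ≤ 1 ∧ 0 < fireProb r p η (i + 1) ∧
      fireProb r p η (i + 1) ≤ η * (r - 1) * silence r p η i := by
  have hr3 : (3 : ℝ) ≤ r := by exact_mod_cast hr
  have hη1 : η < 1 := by nlinarith
  have hfire : ∀ i, 0 < silence r p η i → silence r p η i ≤ 1 - p → 0 < pressure r p η i →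
      silence r p η i + pressure r p η i ≤ 1 → 0 < fireProb r p η (i + 1) ∧
      fireProb r p η (i + 1) ≤ η * (r - 1) * silence r p η i := by
    intro i h1 h2 h3 h4
    refine ⟨mul_pos (mul_pos hη (branchRate_pos hr hp h1)) h3, ?_⟩
    have e1 : silence r p η i ^ (r - 2) ≤ silence r p η i := by
      calc silence r p η i ^ (r - 2) ≤ silence r p η i ^ 1 :=
            pow_le_pow_of_le_one h1.le (by linarith) (by omega)
        _ = _ := pow_one _
    have e2 : 0 < silence r p η i ^ (r - 2) := by positivity
    have e3 : branchRate r p (silence r p η i) ≤ ((r : ℝ) - 1) * silence r p η i := by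
      unfold branchRate
      calc ((r : ℝ) - 1) * (1 - p) * silence r p η i ^ (r - 2)
          ≤ ((r : ℝ) - 1) * 1 * silence r p η i := by gcongr <;> linarith
        _ = _ := by ring
    have e4 := branchRate_pos hr hp h1
    have e5 : pressure r p η i ≤ 1 := by linarith
    calc fireProb r p η (i + 1) ≤ η * (((r : ℝ) - 1) * silence r p η i) * 1 := by
          simp only [fireProb]; gcongr; nlinarith
      _ = _ := by ring
  have hbase : ∀ i, 0 < silence r p η i ∧ silence r p η i ≤ 1 - p ∧ 0 < pressure r p η i ∧
      silence r p η i + pressure r p η i ≤ 1 := by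
    intro i
    induction i with
    | zero =>
      change 0 < 1 - p ∧ 1 - p ≤ 1 - p ∧ 0 < p ∧ 1 - p + p ≤ 1
      exact ⟨by linarith, le_rfl, hp0, by linarith⟩
    | succ i ih =>
      obtain ⟨h1, h2, h3, h4⟩ := ih
      obtain ⟨h5, h6⟩ := hfire i h1 h2 h3 h4
      rw [silence_succ, pressure_succ]
      refine ⟨by nlinarith, by linarith, by nlinarith, by nlinarith⟩
  obtain ⟨h1, h2, h3, h4⟩ := hbase i
  exact ⟨h1, h2, h3, h4, hfire i h1 h2 h3 h4⟩

/-- A round moves the point $(a,y)$ with the slope of the concave curve $y=$ `blueMass` at $a$, so a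
point on or above the curve stays on or above it. -/
lemma blueMass_le_pressure (hr : 3 ≤ r) (hp0 : 0 < p) (hp : p < 1) (hη : 0 < η)
    (hη' : η * ((r : ℝ) - 1) < 1) (i : ℕ) :
    blueMass r p (silence r p η i) ≤ pressure r p η i := by
  induction i with
  | zero => rw [silence_zero, blueMass_one_sub]; exact le_rfl
  | succ i ih =>
    obtain ⟨h1, -, -, -, h5, -⟩ := round_invariant hr hp0 hp hη hη' i
    obtain ⟨h1', -⟩ := round_invariant hr hp0 hp hη hη' (i + 1)
    have h := blueMass_le_tangent hr hp h1' (show silence r p η (i + 1) ≤ silence r p η i by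
      rw [silence_succ]; linarith)
    have hK := (branchRate_pos hr hp h1).ne'
    have e : pressure r p η (i + 1) = pressure r p η i + (silence r p η i - silence r p η (i + 1))
        * (1 - 1 / branchRate r p (silence r p η i)) := by
      rw [pressure_succ, silence_succ]
      simp only [fireProb]
      field_simp
      ring
    rw [e]
    linarith

/-- Otherwise the pressure stays above the positive minimum of the blue mass on
$[\alpha+\delta,1-p]$. Each round lowers $a+y$ by $\eta y$, so $a+y$ would become negative. -/
lemma exists_silence_lt {α : ℝ} (h : IsStop r p α) (hr : 3 ≤ r) (hp0 : 0 < p) (hp : p < 1)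
    (hη : 0 < η) (hη' : η * ((r : ℝ) - 1) < 1) {δ : ℝ} (hδ : 0 < δ) :
    ∃ N, silence r p η N < α + δ := by
  by_contra! hN
  have hinv := round_invariant hr hp0 hp hη hη'
  have hcont : ContinuousOn (blueMass r p) (Set.Icc (α + δ) (1 - p)) := fun x hx =>
    (hasDerivAt_blueMass hr hp (by linarith [hx.1, h.pos])).continuousAt.continuousWithinAt
  obtain ⟨x, hx, hmin⟩ := isCompact_Icc.exists_isMinOn ⟨_, hN 0, (hinv 0).2.1⟩ hcont
  have hm : 0 < blueMass r p x := h.mass_pos x (by linarith [hx.1]) hx.2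
  have hy : ∀ i, blueMass r p x ≤ pressure r p η i := fun i =>
    (hmin ⟨hN i, (hinv i).2.1⟩).trans (blueMass_le_pressure hr hp0 hp hη hη' i)
  have hdec : ∀ i : ℕ, silence r p η i + pressure r p η i ≤ 1 - i * (η * blueMass r p x) := by
    intro i
    induction i with
    | zero => simpa using (hinv 0).2.2.2.1
    | succ i ih =>
      rw [silence_succ, pressure_succ]
      push_cast
      have := mul_le_mul_of_nonneg_left (hy i) hη.le
      linarith
  obtain ⟨n, hn⟩ := exists_nat_gt (1 / (η * blueMass r p x))
  rw [div_lt_iff₀ (by positivity)] at hn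
  have := hdec n
  linarith [(hinv n).1, (hinv n).2.2.1]

/-- A Riemann sum for $\frac{r}{r-1}\int a\,da$: with $c=a_i-a_{i+1}$ the summand is
$\frac{r}{r-1}\,c\,a_{i+1}(a_{i+1}/a_i)^{r-2}$, and the ratio $a_{i+1}/a_i$ is at least
$1-\eta(r-1)$. -/
lemma sum_purple_ge (hr : 3 ≤ r) (hp0 : 0 < p) (hp : p < 1) (hη : 0 < η)
    (hη' : η * ((r : ℝ) - 1) < 1) (N : ℕ) :
    r / (2 * ((r : ℝ) - 1)) * ((1 - p) ^ 2 - silence r p η N ^ 2) - 2 * r ^ 2 * η ≤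
      ∑ i ∈ Finset.range N, r * ((1 - p) * η * pressure r p η i) * silence r p η (i + 1) ^ (r - 1)
        := by
  have hr3 : (3 : ℝ) ≤ r := by exact_mod_cast hr
  have hr1 : 0 < (r : ℝ) - 1 := by linarith
  have hinv := round_invariant hr hp0 hp hη hη'
  -- The error in each round is a multiple of $\eta c$, so the errors telescope and do not grow with
  -- the number of rounds.
  have key : ∀ N, r / (2 * ((r : ℝ) - 1)) * ((1 - p) ^ 2 - silence r p η N ^ 2)
      - r / ((r : ℝ) - 1) * (r ^ 2 * η) * ((1 - p) - silence r p η N) ≤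
      ∑ i ∈ Finset.range N, r * ((1 - p) * η * pressure r p η i)
        * silence r p η (i + 1) ^ (r - 1) := by
    intro N
    induction N with
    | zero => simp [silence_zero]
    | succ i ih =>
      rw [Finset.sum_range_succ]
      obtain ⟨h1, h2, h3, h4, h5, h6⟩ := hinv i
      obtain ⟨h1', h2', -⟩ := hinv (i + 1)
      set a := silence r p η i
      set a' := silence r p η (i + 1) with ha'
      set c := fireProb r p η (i + 1) with hc
      have haa : a' = a - c := silence_succ i
      have hcdef : c = ((r : ℝ) - 1) * ((1 - p) * η * pressure r p η i) * a ^ (r - 2) := by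
        simp only [hc, fireProb, branchRate]; ring
      have hpow : a' ^ (r - 2) ≥ a ^ (r - 2) * (1 - (r : ℝ) ^ 2 * η + r * η) := by
        have e1 : a * (1 - η * (r - 1)) ≤ a' := by rw [haa]; linarith
        have e2 : (1 : ℝ) + (r - 2 : ℕ) * (-(η * (r - 1))) ≤ (1 + -(η * (r - 1))) ^ (r - 2) :=
          one_add_mul_le_pow (by linarith) _
        rw [Nat.cast_sub (by omega)] at e2
        push_cast at e2
        have e3 : (a * (1 - η * (r - 1))) ^ (r - 2) ≤ a' ^ (r - 2) :=
          pow_le_pow_left₀ (mul_nonneg h1.le (by linarith)) e1 _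
        rw [mul_pow] at e3
        have e4 : 1 - (r : ℝ) ^ 2 * η + r * η ≤ (1 - η * (r - 1)) ^ (r - 2) := by
          rw [sub_eq_add_neg (1 : ℝ) (η * (r - 1))]
          nlinarith
        exact (mul_le_mul_of_nonneg_left e4 (by positivity)).trans e3
      have hterm : r * ((1 - p) * η * pressure r p η i) * a' ^ (r - 1) ≥
          r / ((r : ℝ) - 1) * (c * a' * (1 - (r : ℝ) ^ 2 * η + r * η)) := by
        have e : a' ^ (r - 1) = a' ^ (r - 2) * a' := by
          rw [← pow_succ]; congr 1; omega
        rw [e, hcdef]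
        have hy : 0 < (1 - p) * η * pressure r p η i := by
          have : 0 < 1 - p := by linarith
          positivity
        calc r / ((r : ℝ) - 1) * (((r : ℝ) - 1) * ((1 - p) * η * pressure r p η i) * a ^ (r - 2)
              * a' * (1 - (r : ℝ) ^ 2 * η + r * η))
            = r * ((1 - p) * η * pressure r p η i) * ((a ^ (r - 2)
              * (1 - (r : ℝ) ^ 2 * η + r * η)) * a') := by field_simp
          _ ≤ r * ((1 - p) * η * pressure r p η i) * (a' ^ (r - 2) * a') := by gcongr
      have ha1 : a ≤ 1 := by linarith
      have ha1' : a' ≤ 1 := by linarith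
      have hfin : (a ^ 2 - a' ^ 2) / 2 - r ^ 2 * η * c ≤ c * a' * (1 - (r : ℝ) ^ 2 * η + r * η) := by
        have e1 : c * c ≤ c * (η * r) := by
          refine mul_le_mul_of_nonneg_left ?_ h5.le
          have e5 : η * (r - 1) * a ≤ η * (r - 1) * 1 :=
            mul_le_mul_of_nonneg_left ha1 (by positivity)
          linarith
        have e2 : c * a' * ((r : ℝ) ^ 2 * η - r * η) ≤ c * 1 * ((r : ℝ) ^ 2 * η - r * η) := by
          have : 0 ≤ (r : ℝ) ^ 2 * η - r * η := by nlinarith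
          gcongr
        have e3 : (a ^ 2 - a' ^ 2) / 2 = c * a' + c * c / 2 := by rw [haa]; ring
        rw [e3]
        nlinarith
      have hmul := mul_le_mul_of_nonneg_left hfin
        (div_nonneg (by linarith : (0 : ℝ) ≤ r) hr1.le)
      have e5 : r / (2 * ((r : ℝ) - 1)) = r / ((r : ℝ) - 1) / 2 := by field_simp
      rw [e5] at ih ⊢
      have : r / ((r : ℝ) - 1) * (r ^ 2 * η) * (1 - p - a') =
        r / ((r : ℝ) - 1) * (r ^ 2 * η) * (1 - p - a) + r / ((r : ℝ) - 1) * (r ^ 2 * η) * c := by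
          rw [haa]; ring
      rw [this]
      nlinarith
  refine le_trans ?_ (key N)
  obtain ⟨h1, h2, -⟩ := hinv N
  have e1 : r / ((r : ℝ) - 1) ≤ 2 := by rw [div_le_iff₀ hr1]; linarith
  have e2 : 0 ≤ r / ((r : ℝ) - 1) := div_nonneg (by linarith) hr1.le
  have : r / ((r : ℝ) - 1) * (r ^ 2 * η) * ((1 - p) - silence r p η N) ≤ 2 * (r ^ 2 * η) * 1 := by
    gcongr; linarith
  linarith

/-- The discrete process comes as close as one likes to the value `ξ(r, p)`. -/
lemma exists_rounds {α : ℝ} (h : IsStop r p α) (hr : 3 ≤ r) (hp0 : 0 < p) (hp : p < 1)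
    {ε : ℝ} (hε : 0 < ε) : ∃ η N, 0 < η ∧ η * ((r : ℝ) - 1) < 1 ∧
      branchRate r p (silence r p η N) < 1 ∧
      forestGain r p α - ε ≤
        ∑ i ∈ Finset.range N, r * ((1 - p) * η * pressure r p η i) * silence r p η (i + 1) ^ (r - 1)
        + (1 - p) * silence r p η N ^ r := by
  have hr3 : (3 : ℝ) ≤ r := by exact_mod_cast hr
  have hcont : Continuous (forestGain r p) := by unfold forestGain; fun_prop
  have h1 := (hcont.tendsto α).eventually (lt_mem_nhds (sub_lt_self (forestGain r p α) (half_pos hε)))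
  have h2 := (continuous_branchRate.tendsto α).eventually (gt_mem_nhds h.rate_lt)
  obtain ⟨δ, hδ, hball⟩ := Metric.eventually_nhds_iff.1 (h1.and h2)
  -- Then the error $2r^2\eta$ of the Riemann sum is below $\varepsilon/2$, and $\eta(r-1)<1$.
  obtain ⟨η, hη, hη1⟩ : ∃ η : ℝ, 0 < η ∧ 4 * r ^ 2 * η < min ε 1 := by
    refine ⟨min ε 1 / (8 * r ^ 2), by positivity, ?_⟩
    have : 0 < min ε 1 := by positivity
    field_simp
    norm_num
  have hη' : η * ((r : ℝ) - 1) < 1 := by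
    have := hη1.trans_le (min_le_right _ _)
    nlinarith
  have hηε := hη1.trans_le (min_le_left _ _)
  obtain ⟨N, hN⟩ := exists_silence_lt h hr hp0 hp hη hη' (half_pos hδ)
  have hpos := (round_invariant hr hp0 hp hη hη' N).1
  have hgain : forestGain r p α - ε / 2 ≤ forestGain r p (silence r p η N) := by
    -- The discrete process may overshoot $\alpha$, but then the gain is only larger.
    rcases le_total (silence r p η N) α with hle | hle
    · have := forestGain_anti hr hp hpos hle h.rate_lt.le
      linarith
    · refine (hball ?_).1.le
      rw [Real.dist_eq, abs_of_nonneg (by linarith)]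
      linarith
  refine ⟨η, N, hη, hη', ?_, ?_⟩
  · refine lt_of_le_of_lt (branchRate_mono hr hp hpos.le hN.le) (hball ?_).2
    rw [Real.dist_eq, abs_of_nonneg (by linarith)]
    linarith
  · have := sum_purple_ge hr hp0 hp hη hη' N
    unfold forestGain at hgain ⊢
    linarith

end


/-! ### The process on a graph, and why it grows a forest. -/

section

variable {V : Type*}

/-- `Fires G D i u v`: in the process with seeds and delays `D` and with the influence of `v` on
`u` switched off, the vertex `u` turns purple in round `i`. -/
def Fires (G : SimpleGraph V) (D : V → ℕ) (i : ℕ) (u v : V) : Prop :=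
  (i = 0 ∧ D u = 0) ∨ (D u ≠ 0 ∧ ∃ x, G.Adj u x ∧ x ≠ v ∧ ∃ τ : Fin i, Fires G D τ x u ∧
    τ + D u = i ∧ ∀ x', G.Adj u x' → x' ≠ v → x' ≠ x → ∀ τ' : Fin i, ¬ Fires G D τ' x' u)
termination_by i

/-- `v` turns purple in round `i`, and none of its neighbours other than the one that triggers it
fires up to that round. -/
def PurpleAt (G : SimpleGraph V) (D : V → ℕ) (i : ℕ) (v : V) : Prop :=
  (i = 0 ∧ D v = 0 ∧ ∀ x, G.Adj v x → D x ≠ 0) ∨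
  (D v ≠ 0 ∧ ∃ x, G.Adj v x ∧ ∃ τ < i, Fires G D τ x v ∧ τ + D v = i ∧
    ∀ x', G.Adj v x' → x' ≠ x → ∀ τ' ≤ i, ¬ Fires G D τ' x' v)

/-- `v` is not a seed and none of its neighbours fires up to round `N`. -/
def White (G : SimpleGraph V) (D : V → ℕ) (N : ℕ) (v : V) : Prop :=
  D v ≠ 0 ∧ ∀ x, G.Adj v x → ∀ τ ≤ N, ¬ Fires G D τ x v

/-- Some vertex of `T` has at most one neighbour in `T`. -/
def HasLeaf (G : SimpleGraph V) (T : Finset V) : Prop :=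
  ∃ z ∈ T, ∀ x ∈ T, ∀ y ∈ T, G.Adj z x → G.Adj z y → x = y

/-- The forest that the process grows in `N` rounds: the purple vertices, and the white vertices
that lie in no subgraph of minimum degree two made of white vertices. -/
def grownForest (G : SimpleGraph V) (D : V → ℕ) (N : ℕ) : Set V :=
  {v | ∃ i ≤ N, PurpleAt G D i v} ∪
  {v | White G D N v ∧ ∀ T : Finset V, v ∈ T → (∀ x ∈ T, White G D N x) → HasLeaf G T}

variable {G : SimpleGraph V} {D : V → ℕ} {N : ℕ}

/-- The bounded type `Fin i` only serves the termination of the recursion; this form is the one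
used. -/
lemma fires_iff {i : ℕ} {u v : V} : Fires G D i u v ↔
    (i = 0 ∧ D u = 0) ∨ (D u ≠ 0 ∧ ∃ x, G.Adj u x ∧ x ≠ v ∧ ∃ τ < i, Fires G D τ x u ∧
      τ + D u = i ∧ ∀ x', G.Adj u x' → x' ≠ v → x' ≠ x → ∀ τ' < i, ¬ Fires G D τ' x' u) := by
  rw [Fires]
  constructor
  · rintro (h | ⟨h0, x, h1, h2, τ, h3, h4, h5⟩)
    · exact Or.inl h
    · exact Or.inr ⟨h0, x, h1, h2, τ, τ.2, h3, h4, fun x' a b c τ' d => h5 x' a b c ⟨τ', d⟩⟩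
  · rintro (h | ⟨h0, x, h1, h2, τ, hτ, h3, h4, h5⟩)
    · exact Or.inl h
    · exact Or.inr ⟨h0, x, h1, h2, ⟨τ, hτ⟩, h3, h4, fun x' a b c τ' => h5 x' a b c τ' τ'.2⟩

lemma fires_zero_iff {u v : V} : Fires G D 0 u v ↔ D u = 0 := by
  rw [fires_iff]
  simp

/-- With the same trigger, induction gives the same trigger time. With two triggers, the one of the
earlier firing spoils the later firing. -/
lemma Fires.unique {i : ℕ} : ∀ {j : ℕ} {u v : V}, Fires G D i u v → Fires G D j u v → i = j := by
  induction i using Nat.strong_induction_on with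
  | _ i ih =>
    intro j u v h h'
    rw [fires_iff] at h h'
    rcases h with ⟨hi, h0⟩ | ⟨h0, x, h1, h2, τ, hτ, h3, h4, h5⟩
    · rcases h' with ⟨hj, -⟩ | ⟨h0', -⟩
      · rw [hi, hj]
      · exact absurd h0 h0'
    · rcases h' with ⟨-, h0'⟩ | ⟨-, x', h1', h2', τ', hτ', h3', h4', h5'⟩
      · exact absurd h0' h0
      · by_cases hx : x = x'
        · subst hx
          have := ih τ hτ h3 h3'
          omega
        · rcases le_total i j with hij | hij
          · exact absurd h3 (h5' x h1 h2 hx τ (by omega))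
          · exact absurd h3' (h5 x' h1' h2' (Ne.symm hx) τ' (by omega))

/-- If $x$ has not fired towards $v$ in time, then $x$ is not the trigger, and switching off its
influence changes nothing. -/
lemma PurpleAt.fires {i : ℕ} {v x : V} (h : PurpleAt G D i v)
    (hn : ∀ τ ≤ i, ¬ Fires G D τ x v) : Fires G D i v x := by
  rw [fires_iff]
  rcases h with ⟨h1, h2, -⟩ | ⟨h0, y, hy, τ, hτ, hf, hs, ho⟩
  · exact Or.inl ⟨h1, h2⟩
  · refine Or.inr ⟨h0, y, hy, ?_, τ, hτ, hf, hs, fun x' a _ c τ' d => ho x' a c τ' d.le⟩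
    rintro rfl
    exact hn τ hτ.le hf

/-- A purple vertex has at most one neighbour that fired before it. -/
lemma PurpleAt.parent_unique {j τ τ' : ℕ} {u v v' : V} (h : PurpleAt G D j u) (hv : G.Adj u v)
    (hv' : G.Adj u v') (hf : Fires G D τ v u) (hτ : τ ≤ j) (hf' : Fires G D τ' v' u)
    (hτ' : τ' ≤ j) : v = v' := by
  rcases h with ⟨rfl, -, h2⟩ | ⟨h0, y, hy, σ, hσ, hfy, hs, ho⟩
  · obtain rfl : τ = 0 := by omega
    exact absurd (fires_zero_iff.1 hf) (h2 v hv)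
  · by_cases h1 : v = y
    · by_cases h2 : v' = y
      · rw [h1, h2]
      · exact absurd hf' (ho v' hv' h2 τ' hτ')
    · exact absurd hf (ho v hv h1 τ hτ)

lemma PurpleAt.lt_of_fires {j τ : ℕ} {u v : V} (h : PurpleAt G D j u) (hv : G.Adj u v)
    (hf : Fires G D τ v u) (hτ : τ ≤ j) : τ < j := by
  rcases h with ⟨rfl, -, h2⟩ | ⟨h0, y, hy, σ, hσ, hfy, hs, ho⟩
  · obtain rfl : τ = 0 := by omega
    exact absurd (fires_zero_iff.1 hf) (h2 v hv)
  · by_cases h1 : v = y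
    · subst h1
      rw [hf.unique hfy]
      exact hσ
    · exact absurd hf (ho v hv h1 τ hτ)

/-- If `u` triggers the purple vertex `v`, then `v` does not fire towards `u` in time. -/
lemma PurpleAt.lt_of_fires_back {i σ τ : ℕ} {u v : V} (h : PurpleAt G D i v) (hu : G.Adj v u)
    (hf : Fires G D σ u v) (hσ : σ ≤ i) (hb : Fires G D τ v u) : i < τ := by
  rw [fires_iff] at hb
  have hpu : ∀ x ρ, G.Adj v x → Fires G D ρ x v → ρ ≤ i → u = x := fun x ρ hx hfx hρ =>
    h.parent_unique hu hx hf hσ hfx hρ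
  rcases hb with ⟨-, h0⟩ | ⟨h0, x, hx, hxu, ρ, hρ, hfx, -, -⟩
  · rcases h with ⟨rfl, -, h2⟩ | ⟨h0', -⟩
    · obtain rfl : σ = 0 := by omega
      exact absurd (fires_zero_iff.1 hf) (h2 u hu)
    · exact absurd h0 h0'
  · by_contra hlt
    exact hxu (hpu x ρ hx hfx (by omega)).symm

/-- If neither received the other's message in time, both would send it, and the earlier one would
arrive in time. If both did, then $i<\tau\le j<\sigma\le i$ for the two message times. -/
lemma PurpleAt.lt_or_lt {i j : ℕ} {u v : V} (hv : PurpleAt G D i v) (hu : PurpleAt G D j u)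
    (huv : G.Adj u v) : (Fires G D i v u ∧ i < j) ∨ (Fires G D j u v ∧ j < i) := by
  by_cases h1 : ∃ τ ≤ j, Fires G D τ v u
  · obtain ⟨τ, hτ, hf⟩ := h1
    have hlt := hu.lt_of_fires huv hf hτ
    by_cases h2 : ∃ σ ≤ i, Fires G D σ u v
    · obtain ⟨σ, hσ, hf'⟩ := h2
      have a := hv.lt_of_fires huv.symm hf' hσ
      have b := hv.lt_of_fires_back huv.symm hf' hσ hf
      have c := hu.lt_of_fires_back huv hf hτ hf'
      omega
    · push Not at h2
      have h3 := hv.fires h2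
      rw [h3.unique hf]
      exact Or.inl ⟨hf, hlt⟩
  · push Not at h1
    have h3 := hu.fires h1
    by_cases h2 : ∃ σ ≤ i, Fires G D σ u v
    · obtain ⟨σ, hσ, hf⟩ := h2
      have := hv.lt_of_fires huv.symm hf hσ
      rw [h3.unique hf]
      exact Or.inr ⟨hf, this⟩
    · push Not at h2
      have h4 := hv.fires h2
      have a : ¬ i ≤ j := fun h => h1 i h h4
      have b : ¬ j ≤ i := fun h => h2 j h h3
      omega

/-- To fire, $v$ would have to be a seed or have been hit, so it does not fire towards $u$; hence
$u$ fires towards $v$, which is then not white. -/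
lemma White.not_adj_purple {i : ℕ} {u v : V} (hv : White G D N v) (hu : PurpleAt G D i u)
    (hi : i ≤ N) (huv : G.Adj u v) : False := by
  by_cases h : ∃ τ ≤ i, Fires G D τ v u
  · obtain ⟨τ, hτ, hf⟩ := h
    rw [fires_iff] at hf
    rcases hf with ⟨-, h0⟩ | ⟨-, x, hx, -, ρ, hρ, hfx, -, -⟩
    · exact hv.1 h0
    · exact hv.2 x hx ρ (by omega) hfx
  · push Not at h
    exact hv.2 u huv.symm i hi (hu.fires h)

/-- The vertices of a cycle form a set in which each has two neighbours. -/
lemma isAcyclic_induce_of_hasLeaf {S : Set V}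
    (h : ∀ T : Finset V, (T : Set V) ⊆ S → T.Nonempty → HasLeaf G T) : (G.induce S).IsAcyclic := by
  classical
  intro v c hc
  obtain ⟨z, hz, hz'⟩ := h (c.support.toFinset.image Subtype.val) (by
    intro x hx
    simp only [Finset.coe_image, Set.mem_image] at hx
    obtain ⟨y, -, rfl⟩ := hx
    exact y.2) ⟨v, by simp⟩
  obtain ⟨z, hzs, rfl⟩ := Finset.mem_image.1 hz
  have h2 := hc.ncard_neighborSet_toSubgraph_eq_two (List.mem_toFinset.1 hzs)
  obtain ⟨x, y, hxy, he⟩ := Set.ncard_eq_two.1 h2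
  have hx : c.toSubgraph.Adj z x := by
    have : x ∈ c.toSubgraph.neighborSet z := by rw [he]; simp
    exact this
  have hy : c.toSubgraph.Adj z y := by
    have : y ∈ c.toSubgraph.neighborSet z := by rw [he]; simp
    exact this
  have hmem : ∀ w, c.toSubgraph.Adj z w → (w : V) ∈ c.support.toFinset.image Subtype.val := by
    intro w hw
    refine Finset.mem_image_of_mem _ (List.mem_toFinset.2 ?_)
    exact (SimpleGraph.Walk.mem_verts_toSubgraph c).1 hw.snd_mem
  exact hxy (Subtype.ext (hz' x (hmem x hx) y (hmem y hy) hx.adj_sub hy.adj_sub))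

/-- In a finite set of forest vertices the latest purple vertex is a leaf: it has no white neighbour
there, all its purple neighbours there fired before it, and only one neighbour can have done so. A
set without purple vertices has a leaf by the definition of the forest. -/
theorem isAcyclic_grownForest : (G.induce (grownForest G D N)).IsAcyclic := by
  classical
  refine isAcyclic_induce_of_hasLeaf fun T hT hne => ?_
  set P := T.filter fun v => ∃ i ≤ N, PurpleAt G D i v with hP
  by_cases hPe : P.Nonempty
  · have hex : ∀ v, ∃ i, v ∈ P → i ≤ N ∧ PurpleAt G D i v := by
      intro v
      by_cases hv : v ∈ P
      · obtain ⟨i, hi⟩ := (Finset.mem_filter.1 hv).2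
        exact ⟨i, fun _ => hi⟩
      · exact ⟨0, fun h => absurd h hv⟩
    choose time htime using hex
    obtain ⟨u, hu, hmax⟩ := P.exists_max_image time hPe
    have hin : ∀ x ∈ T, G.Adj u x → x ∈ P := by
      intro x hx hux
      rcases hT hx with h | h
      · exact Finset.mem_filter.2 ⟨hx, h⟩
      · exact (h.1.not_adj_purple (htime u hu).2 (htime u hu).1 hux).elim
    have hpar : ∀ x ∈ T, G.Adj u x → Fires G D (time x) x u ∧ time x < time u := by
      intro x hx hux
      have hxP := hin x hx hux
      rcases (htime x hxP).2.lt_or_lt (htime u hu).2 hux with h | h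
      · exact h
      · exact absurd h.2 (not_lt.2 (hmax x hxP))
    refine ⟨u, (Finset.mem_filter.1 hu).1, fun x hx y hy hux huy => ?_⟩
    exact (htime u hu).2.parent_unique hux huy (hpar x hx hux).1 (hpar x hx hux).2.le
      (hpar y hy huy).1 (hpar y hy huy).2.le
  · have hW : ∀ x ∈ T, White G D N x ∧ ∀ T : Finset V, x ∈ T → (∀ y ∈ T, White G D N y) →
        HasLeaf G T := by
      intro x hx
      rcases hT hx with h | h
      · exact absurd ⟨x, Finset.mem_filter.2 ⟨hx, h⟩⟩ hPe
      · exact h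
    obtain ⟨v, hv⟩ := hne
    exact (hW v hv).2 T hv fun x hx => (hW x hx).1

end


/-! ### Independence of events that read disjoint sets of labels. -/

section

variable {V : Type*}

lemma dependsOn_inter {A B : Set (V → ℕ)} {S T : Set V}
    (hA : DependsOn (· ∈ A) S) (hB : DependsOn (· ∈ B) T) : DependsOn (· ∈ A ∩ B) (S ∪ T) := by
  intro x y h
  simp only [Set.mem_inter_iff, eq_iff_iff]
  exact and_congr (iff_of_eq (hA fun i hi => h i (Or.inl hi)))
    (iff_of_eq (hB fun i hi => h i (Or.inr hi)))

lemma dependsOn_biInter {ι : Type*} {X : Finset ι} {A : ι → Set (V → ℕ)} {S : ι → Set V}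
    (hA : ∀ x ∈ X, DependsOn (· ∈ A x) (S x)) :
    DependsOn (· ∈ ⋂ x ∈ X, A x) (⋃ x ∈ X, S x) := by
  intro ω ω' h
  simp only [Set.mem_iInter, eq_iff_iff]
  refine forall₂_congr fun x hx => iff_of_eq (hA x hx fun i hi => h i ?_)
  exact Set.mem_biUnion hx hi

lemma dependsOn_label (y : V) (s : Set ℕ) :
    DependsOn (fun ω : V → ℕ => ω ∈ {ω : V → ℕ | ω y ∈ s}) {y} := by
  intro ω ω' h
  simp only [Set.mem_ofPred_eq, h y rfl]

variable [Fintype V] {ν : Measure ℕ}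

lemma measurableSet_labels (A : Set (V → ℕ)) : MeasurableSet A := (Set.to_countable A).measurableSet

section

variable [IsProbabilityMeasure ν]

/-- Events that depend on disjoint sets of labels are independent. -/
lemma measureReal_inter_of_dependsOn {A B : Set (V → ℕ)} {S T : Set V}
    (hA : DependsOn (· ∈ A) S) (hB : DependsOn (· ∈ B) T) (hST : Disjoint S T) :
    (Measure.pi fun _ : V => ν).real (A ∩ B) =
      (Measure.pi fun _ : V => ν).real A * (Measure.pi fun _ : V => ν).real B := by
  classical
  have hind : ProbabilityTheory.iIndepFun (fun (i : V) (ω : V → ℕ) => ω i)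
      (Measure.pi fun _ : V => ν) :=
    ProbabilityTheory.iIndepFun_pi (X := fun _ => id) fun _ => aemeasurable_id
  have h2 := hind.indepFun_finset S.toFinset T.toFinset (by simpa using hST)
    fun i => measurable_pi_apply i
  -- The event is a preimage under restriction to `S`; the labels outside `S` are irrelevant and are
  -- filled with `0`.
  have key : ∀ {A : Set (V → ℕ)} {S : Set V}, DependsOn (· ∈ A) S →
      A = (fun (ω : V → ℕ) (i : S.toFinset) => ω i) ⁻¹'
        {x | (fun i => if h : i ∈ S.toFinset then x ⟨i, h⟩ else 0) ∈ A} := by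
    intro A S hA
    ext ω
    simp only [Set.mem_preimage, Set.mem_ofPred_eq]
    refine iff_of_eq (hA fun i hi => ?_)
    simp [hi]
  have h3 := h2.measure_inter_preimage_eq_mul _ _ (Set.to_countable
    {x | (fun i => if h : i ∈ S.toFinset then x ⟨i, h⟩ else 0) ∈ A}).measurableSet
    (Set.to_countable {x | (fun i => if h : i ∈ T.toFinset then x ⟨i, h⟩ else 0) ∈ B}).measurableSet
  rw [← key hA, ← key hB] at h3
  simp only [Measure.real, h3, ENNReal.toReal_mul]

lemma measureReal_biInter_of_dependsOn {ι : Type*} {X : Finset ι} {A : ι → Set (V → ℕ)}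
    {S : ι → Set V} (hA : ∀ x ∈ X, DependsOn (· ∈ A x) (S x))
    (hS : (X : Set ι).PairwiseDisjoint S) :
    (Measure.pi fun _ : V => ν).real (⋂ x ∈ X, A x) =
      ∏ x ∈ X, (Measure.pi fun _ : V => ν).real (A x) := by
  classical
  induction X using Finset.induction_on with
  | empty => simp
  | insert a X ha ih =>
    rw [Finset.prod_insert ha, Finset.set_biInter_insert,
      measureReal_inter_of_dependsOn (hA a (Finset.mem_insert_self a X))
        (dependsOn_biInter fun x hx => hA x (Finset.mem_insert_of_mem hx)), ih]
    · exact fun x hx => hA x (Finset.mem_insert_of_mem hx)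
    · exact hS.subset (by simp)
    · refine Set.disjoint_iUnion₂_right.2 fun x hx => ?_
      refine hS (by simp) (by simp [hx]) ?_
      rintro rfl
      exact ha hx

lemma measureReal_label (y : V) (s : Set ℕ) :
    (Measure.pi fun _ : V => ν).real {ω | ω y ∈ s} = ν.real s := by
  have h := (measurePreserving_eval (fun _ : V => ν) y).measure_preimage
    (MeasurableSet.of_discrete (s := s)).nullMeasurableSet
  simp only [Measure.real]
  rw [← h]
  rfl

end

/-- The events attached to the branches at a vertex `y`: each branch `x` fires at most once, at time
`τ` with probability `c τ`, as a function of the labels in `S x`. -/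
structure Branches (ν : Measure ℕ) (y : V) (X : Finset V) (S : V → Set V) (E : V → ℕ → Set (V → ℕ))
    (c : ℕ → ℝ) (j : ℕ) : Prop where
  dep : ∀ x ∈ X, ∀ τ < j, DependsOn (· ∈ E x τ) (S x)
  disj : (X : Set V).PairwiseDisjoint S
  not_mem : ∀ x ∈ X, y ∉ S x
  prob : ∀ x ∈ X, ∀ τ < j, (Measure.pi fun _ : V => ν).real (E x τ) = c τ
  once : ∀ x ∈ X, ∀ τ τ', τ ≠ τ' → Disjoint (E x τ) (E x τ')

/-- The branch `x` is silent before round `j`. -/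
def silentSet (E : V → ℕ → Set (V → ℕ)) (j : ℕ) (x : V) : Set (V → ℕ) :=
  {ω | ∀ τ < j, ω ∉ E x τ}

namespace Branches

variable {y : V} {X : Finset V} {S : V → Set V} {E : V → ℕ → Set (V → ℕ)} {c : ℕ → ℝ} {j : ℕ}

lemma dependsOn_silent (h : Branches ν y X S E c j) {x : V} (hx : x ∈ X) :
    DependsOn (· ∈ silentSet E j x) (S x) := by
  intro ω ω' hω
  simp only [silentSet, Set.mem_ofPred_eq, eq_iff_iff]
  exact forall₂_congr fun τ hτ => not_congr (iff_of_eq (h.dep x hx τ hτ hω))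

variable [IsProbabilityMeasure ν]

lemma prob_silent (h : Branches ν y X S E c j) {x : V} (hx : x ∈ X) :
    (Measure.pi fun _ : V => ν).real (silentSet E j x) = 1 - ∑ τ ∈ Finset.range j, c τ := by
  have h1 : silentSet E j x = (⋃ τ ∈ Finset.range j, E x τ)ᶜ := by
    ext ω
    simp [silentSet]
  rw [h1, probReal_compl_eq_one_sub (measurableSet_labels _), measureReal_biUnion_finset]
  · exact congrArg _ (Finset.sum_congr rfl fun τ hτ => h.prob x hx τ (Finset.mem_range.1 hτ))
  · exact fun τ _ τ' _ hne => h.once x hx τ τ' hne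
  · exact fun _ _ => measurableSet_labels _

/-- Independence of the label of `y`, one distinguished branch and the silence of the others. -/
lemma prob_single (h : Branches ν y X S E c j) {x : V} (hx : x ∈ X) (s : Set ℕ)
    {A : Set (V → ℕ)} (hA : DependsOn (· ∈ A) (S x)) :
    (Measure.pi fun _ : V => ν).real
      ({ω | ω y ∈ s} ∩ (A ∩ {ω | ∀ x' ∈ X, x' ≠ x → ω ∈ silentSet E j x'})) =
      ν.real s * (Measure.pi fun _ : V => ν).real A
        * (1 - ∑ τ ∈ Finset.range j, c τ) ^ (X.card - 1) := by
  classical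
  have h1 : {ω | ∀ x' ∈ X, x' ≠ x → ω ∈ silentSet E j x'} = ⋂ x' ∈ X.erase x, silentSet E j x' := by
    ext ω
    simp only [Set.mem_ofPred_eq, Set.mem_iInter, Finset.mem_erase]
    exact ⟨fun h x' hx' => h x' hx'.2 hx'.1, fun h x' a b => h x' ⟨b, a⟩⟩
  have h2 : DependsOn (· ∈ ⋂ x' ∈ X.erase x, silentSet E j x') (⋃ x' ∈ X.erase x, S x') :=
    dependsOn_biInter fun x' hx' => h.dependsOn_silent (Finset.mem_of_mem_erase hx')
  rw [h1, measureReal_inter_of_dependsOn (dependsOn_label y s) (dependsOn_inter hA h2),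
    measureReal_inter_of_dependsOn hA h2, measureReal_biInter_of_dependsOn
      (fun x' hx' => h.dependsOn_silent (Finset.mem_of_mem_erase hx')), measureReal_label,
    Finset.prod_congr rfl fun x' hx' => h.prob_silent (Finset.mem_of_mem_erase hx'),
    Finset.prod_const, Finset.card_erase_of_mem hx, mul_assoc]
  · exact h.disj.subset (by simp)
  · refine Set.disjoint_iUnion₂_right.2 fun x' hx' => ?_
    exact h.disj hx (Finset.mem_of_mem_erase hx') (Finset.ne_of_mem_erase hx').symm
  · rw [Set.disjoint_singleton_left]
    rintro (h3 | h3)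
    · exact h.not_mem x hx h3
    · obtain ⟨x', hx', h4⟩ := Set.mem_iUnion₂.1 h3
      exact h.not_mem x' (Finset.mem_of_mem_erase hx') h4

lemma prob_all_silent (h : Branches ν y X S E c j) (s : Set ℕ) :
    (Measure.pi fun _ : V => ν).real ({ω | ω y ∈ s} ∩ {ω | ∀ x ∈ X, ω ∈ silentSet E j x}) =
      ν.real s * (1 - ∑ τ ∈ Finset.range j, c τ) ^ X.card := by
  have h1 : {ω | ∀ x ∈ X, ω ∈ silentSet E j x} = ⋂ x ∈ X, silentSet E j x := by
    ext ω; simp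
  rw [h1, measureReal_inter_of_dependsOn (dependsOn_label y s)
      (dependsOn_biInter fun x hx => h.dependsOn_silent hx), measureReal_biInter_of_dependsOn
      (fun x hx => h.dependsOn_silent hx) h.disj, measureReal_label,
    Finset.prod_congr rfl fun x hx => h.prob_silent hx, Finset.prod_const]
  rw [Set.disjoint_singleton_left]
  intro h3
  obtain ⟨x, hx, h4⟩ := Set.mem_iUnion₂.1 h3
  exact h.not_mem x hx h4

/-- The probability that exactly one branch fires before round `j` and that it makes `y` turn purple
in round `i`. -/
lemma prob_trigger (h : Branches ν y X S E c j) {i : ℕ} (hij : i ≤ j) :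
    (Measure.pi fun _ : V => ν).real {ω | ∃ x ∈ X, ∃ τ < i, ω ∈ E x τ ∧ τ + ω y = i ∧
      ∀ x' ∈ X, x' ≠ x → ω ∈ silentSet E j x'} =
    X.card * (∑ τ ∈ Finset.range i, ν.real {i - τ} * c τ)
      * (1 - ∑ τ ∈ Finset.range j, c τ) ^ (X.card - 1) := by
  -- The triggering branch and its time are determined by the labels, so the union over them is
  -- disjoint. Both $j=i$ (firing) and $j=i+1$ (turning purple) are needed.
  have h1 : {ω | ∃ x ∈ X, ∃ τ < i, ω ∈ E x τ ∧ τ + ω y = i ∧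
      ∀ x' ∈ X, x' ≠ x → ω ∈ silentSet E j x'} =
      ⋃ q ∈ X ×ˢ Finset.range i, ({ω : V → ℕ | ω y ∈ ({i - q.2} : Set ℕ)} ∩ (E q.1 q.2 ∩
        {ω | ∀ x' ∈ X, x' ≠ q.1 → ω ∈ silentSet E j x'})) := by
    ext ω
    simp only [Set.mem_ofPred_eq, Set.mem_iUnion, Finset.mem_product, Finset.mem_range,
      Set.mem_inter_iff, Set.mem_singleton_iff, exists_prop, Prod.exists]
    constructor
    · rintro ⟨x, hx, τ, hτ, h2, h3, h4⟩
      exact ⟨x, τ, ⟨hx, hτ⟩, by omega, h2, h4⟩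
    · rintro ⟨x, τ, ⟨hx, hτ⟩, h3, h2, h4⟩
      exact ⟨x, hx, τ, hτ, h2, by omega, h4⟩
  rw [h1, measureReal_biUnion_finset]
  · have h2 : ∀ q ∈ X ×ˢ Finset.range i, (Measure.pi fun _ : V => ν).real
        ({ω : V → ℕ | ω y ∈ ({i - q.2} : Set ℕ)} ∩ (E q.1 q.2 ∩
          {ω | ∀ x' ∈ X, x' ≠ q.1 → ω ∈ silentSet E j x'})) =
        (ν.real {i - q.2} * c q.2) * (1 - ∑ τ ∈ Finset.range j, c τ) ^ (X.card - 1) := by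
      intro q hq
      obtain ⟨hq1, hq2⟩ := Finset.mem_product.1 hq
      have hq3 : q.2 < j := (Finset.mem_range.1 hq2).trans_le hij
      rw [h.prob_single hq1 _ (h.dep q.1 hq1 q.2 hq3), h.prob q.1 hq1 q.2 hq3]
    rw [Finset.sum_congr rfl h2, ← Finset.sum_mul, Finset.sum_product]
    simp
  · intro q hq q' hq' hne
    obtain ⟨hq1, hq2⟩ := Finset.mem_product.1 hq
    obtain ⟨hq1', hq2'⟩ := Finset.mem_product.1 hq'
    rw [Function.onFun, Set.disjoint_left]
    rintro ω ⟨-, hE, hs⟩ ⟨-, hE', hs'⟩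
    by_cases hx : q.1 = q'.1
    · have hτ : q.2 ≠ q'.2 := fun h3 => hne (Prod.ext hx h3)
      rw [← hx] at hE'
      exact Set.disjoint_left.1 (h.once q.1 hq1 _ _ hτ) hE hE'
    · exact hs' q.1 hq1 hx q.2 ((Finset.mem_range.1 hq2).trans_le hij) hE
  · exact fun _ _ => measurableSet_labels _

end Branches

end


/-! ### The law of the process in a tree-like neighbourhood. -/

section

variable {V : Type*}

/-- The ball of radius `g` around `v` is a tree: `h` is the distance from `v` and `par` maps a vertex
to its parent. -/
structure Rooting (G : SimpleGraph V) (v : V) (g : ℕ) (h : V → ℕ) (par : V → V) : Prop where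
  root : h v = 0
  par_root : par v = v
  adj : ∀ z w, h z < g → G.Adj z w → (h w = h z + 1 ∧ par w = z) ∨ (h z = h w + 1 ∧ par z = w)
  par_adj : ∀ z, 0 < h z → h z ≤ g → G.Adj z (par z)

/-- The descendants of `y`. -/
def below (h : V → ℕ) (par : V → V) (y : V) : Set V := {z | ∃ j, par^[j] z = y ∧ h z = h y + j}

/-- A chain of `k` vertices going down from `y`, on which all branches off the chain are silent up
to round `N`. -/
def WhiteChain (G : SimpleGraph V) (D : V → ℕ) (N : ℕ) (par : V → V) : ℕ → V → Prop
  | 0, _ => True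
  | k + 1, y => D y ≠ 0 ∧ ∃ x, (G.Adj y x ∧ x ≠ par y) ∧ WhiteChain G D N par k x ∧
      ∀ x', G.Adj y x' ∧ x' ≠ par y → x' ≠ x → ∀ τ < N + 1, ¬ Fires G D τ x' y

variable {G : SimpleGraph V} {v : V} {g : ℕ} {h : V → ℕ} {par : V → V}

lemma self_mem_below (y : V) : y ∈ below h par y := ⟨0, rfl, rfl⟩

lemma below_subset {x y : V} (hx : h x = h y + 1) (hp : par x = y) :
    below h par x ⊆ below h par y := by
  rintro z ⟨j, hj, hz⟩
  exact ⟨j + 1, by rw [Function.iterate_succ_apply', hj, hp], by omega⟩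

lemma not_mem_below {x y : V} (hx : h x = h y + 1) : y ∉ below h par x := by
  rintro ⟨j, -, hj⟩
  omega

lemma disjoint_below {x y : V} (hxy : h x = h y) (hne : x ≠ y) :
    Disjoint (below h par x) (below h par y) := by
  rw [Set.disjoint_left]
  rintro z ⟨j, hj, hz⟩ ⟨j', hj', hz'⟩
  obtain rfl : j = j' := by omega
  exact hne (hj.symm.trans hj')

lemma Rooting.kid (R : Rooting G v g h par) {x y : V} (hy : h y < g) (hxy : G.Adj y x)
    (hx : x ≠ par y) : h x = h y + 1 ∧ par x = y := by
  rcases R.adj y x hy hxy with h1 | h1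
  · exact h1
  · exact absurd h1.2.symm hx

/-- A message sent upwards reads only labels below its sender. Each level takes at least one round,
so round $i$ reads at most $i$ levels and stays in the ball. -/
lemma Rooting.dependsOn_fires (R : Rooting G v g h par) (i : ℕ) : ∀ y, h y + i ≤ g →
    DependsOn (· ∈ {ω | Fires G ω i y (par y)}) (below h par y) := by
  induction i using Nat.strong_induction_on with
  | _ i ih =>
    intro y hyi
    have key : ∀ ω ω' : V → ℕ, (∀ z ∈ below h par y, ω z = ω' z) → Fires G ω i y (par y) →
        Fires G ω' i y (par y) := by
      intro ω ω' hω hf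
      have hy := hω y (self_mem_below y)
      have hkid : ∀ x, G.Adj y x → x ≠ par y → ∀ τ < i, (Fires G ω τ x y ↔ Fires G ω' τ x y) := by
        intro x hx hxp τ hτ
        obtain ⟨h1, h2⟩ := R.kid (by omega) hx hxp
        have h3 := ih τ hτ x (by omega) (fun z hz => hω z (below_subset h1 h2 hz))
        rw [h2] at h3
        exact iff_of_eq h3
      rw [fires_iff] at hf ⊢
      rcases hf with ⟨h1, h2⟩ | ⟨h0, x, h1, h2, τ, hτ, h3, h4, h5⟩
      · exact Or.inl ⟨h1, hy ▸ h2⟩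
      · refine Or.inr ⟨hy ▸ h0, x, h1, h2, τ, hτ, (hkid x h1 h2 τ hτ).1 h3, hy ▸ h4, ?_⟩
        intro x' a b c τ' d
        rw [← hkid x' a b τ' d]
        exact h5 x' a b c τ' d
    intro ω ω' hω
    exact propext ⟨key ω ω' hω, key ω' ω fun z hz => (hω z hz).symm⟩

lemma Rooting.dependsOn_fires_kid (R : Rooting G v g h par) {x y : V} {i : ℕ} (hy : h y + i < g)
    (hxy : G.Adj y x) (hx : x ≠ par y) :
    DependsOn (· ∈ {ω | Fires G ω i x y}) (below h par x) := by
  obtain ⟨h1, h2⟩ := R.kid (by omega) hxy hx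
  have := R.dependsOn_fires i x (by omega)
  rwa [h2] at this

lemma Rooting.dependsOn_whiteChain (R : Rooting G v g h par) {N : ℕ} (k : ℕ) : ∀ y,
    h y + k + N ≤ g → DependsOn (· ∈ {ω | WhiteChain G ω N par k y}) (below h par y) := by
  induction k with
  | zero =>
    intro y _ ω ω' _
    simp [WhiteChain]
  | succ k ih =>
    intro y hy ω ω' hω
    simp only [Set.mem_ofPred_eq, eq_iff_iff, WhiteChain]
    have hkid : ∀ x, G.Adj y x ∧ x ≠ par y → below h par x ⊆ below h par y ∧ h x = h y + 1 := by
      intro x hx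
      obtain ⟨h1, h2⟩ := R.kid (by omega) hx.1 hx.2
      exact ⟨below_subset h1 h2, h1⟩
    refine and_congr (by rw [hω y (self_mem_below y)]) (exists_congr fun x =>
      and_congr_right fun hx => and_congr (iff_of_eq (ih x (by have := (hkid x hx).2; omega)
        fun z hz => hω z ((hkid x hx).1 hz))) ?_)
    refine forall₂_congr fun x' hx' => imp_congr_right fun _ => forall₂_congr fun τ hτ =>
      not_congr (iff_of_eq ?_)
    exact R.dependsOn_fires_kid (by omega) hx'.1 hx'.2 fun z hz => hω z ((hkid x' hx').1 hz)

/-- A vertex of a white subgraph of minimum degree two starts a long white chain. -/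
lemma Rooting.whiteChain_of_not_hasLeaf (R : Rooting G v g h par) {D : V → ℕ} {N : ℕ}
    {T : Finset V} (hW : ∀ x ∈ T, White G D N x) (hT : ¬ HasLeaf G T) (k : ℕ) : ∀ y ∈ T,
    h y + k ≤ g → WhiteChain G D N par k y := by
  have hex : ∀ y ∈ T, ∃ x ∈ T, G.Adj y x ∧ x ≠ par y := by
    intro y hy
    by_contra! hno
    refine hT ⟨y, hy, fun x hx z hz hyx hyz => ?_⟩
    rw [hno x hx hyx, hno z hz hyz]
  induction k with
  | zero => exact fun _ _ _ => trivial
  | succ k ih =>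
    intro y hy hyk
    obtain ⟨x, hx, hxy⟩ := hex y hy
    have h1 := (R.kid (by omega) hxy.1 hxy.2).1
    refine ⟨(hW y hy).1, x, hxy, ih x hx (by omega), fun x' hx' _ τ hτ => ?_⟩
    exact (hW y hy).2 x' hx'.1 τ (by omega)

lemma PurpleAt.unique {D : V → ℕ} {i j : ℕ} (hi : PurpleAt G D i v) (hj : PurpleAt G D j v) :
    i = j := by
  have hi' := hi
  have hj' := hj
  rcases hi with ⟨rfl, h0, -⟩ | ⟨h0, x, hx, τ, hτ, hf, hs, -⟩
  · rcases hj with ⟨rfl, -, -⟩ | ⟨h0', -⟩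
    · rfl
    · exact absurd h0 h0'
  · rcases hj with ⟨-, h0', -⟩ | ⟨-, x', hx', τ', hτ', hf', hs', -⟩
    · exact absurd h0' h0
    · have hxx : x = x' := by
        rcases le_total i j with hij | hij
        · exact hj'.parent_unique hx hx' hf (by omega) hf' hτ'.le
        · exact hi'.parent_unique hx hx' hf hτ.le hf' (by omega)
      subst hxx
      have := hf.unique hf'
      omega

lemma White.not_purple {D : V → ℕ} {i N : ℕ} (hw : White G D N v) (hi : i ≤ N)
    (hp : PurpleAt G D i v) : False := by
  rcases hp with ⟨-, h0, -⟩ | ⟨-, x, hx, τ, hτ, hf, -, -⟩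
  · exact hw.1 h0
  · exact hw.2 x hx τ (by omega) hf

variable [Fintype V]

open Classical in
/-- The neighbours of `y` other than its parent. -/
def kids (G : SimpleGraph V) (par : V → V) (y : V) : Finset V :=
  Finset.univ.filter fun x => G.Adj y x ∧ x ≠ par y

lemma mem_kids {x y : V} : x ∈ kids G par y ↔ G.Adj y x ∧ x ≠ par y := by simp [kids]

lemma Rooting.card_kids_root (R : Rooting G v g h par) {r : ℕ}
    (hdeg : ∀ y, (G.neighborSet y).ncard = r) : (kids G par v).card = r := by
  rw [← hdeg v, ← Set.ncard_coe_finset]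
  congr 1
  ext x
  simp only [Finset.mem_coe, mem_kids, R.par_root, SimpleGraph.mem_neighborSet]
  exact ⟨fun h => h.1, fun h => ⟨h, h.ne'⟩⟩

lemma Rooting.card_kids (R : Rooting G v g h par) {r : ℕ}
    (hdeg : ∀ y, (G.neighborSet y).ncard = r) {y : V} (hy : 0 < h y) (hyg : h y ≤ g) :
    (kids G par y).card = r - 1 := by
  have h1 : (G.neighborSet y \ {par y}).ncard = r - 1 := by
    rw [Set.ncard_sdiff_singleton_of_mem
      (show par y ∈ G.neighborSet y from R.par_adj y hy hyg), hdeg]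
  rw [← h1, ← Set.ncard_coe_finset]
  congr 1
  ext x
  simp [mem_kids]

variable {ν : Measure ℕ} {r : ℕ} {p η : ℝ}

/-- Distinct children have disjoint sets of descendants, hence independent messages. The law is a
hypothesis because it is being proved by induction when this is first used. -/
lemma Rooting.branches (R : Rooting G v g h par) {y : V} {j : ℕ} (hy : h y < g) (hyj : h y + j ≤ g)
    (hlaw : ∀ τ < j, ∀ x, 0 < h x → h x + τ ≤ g →
      (Measure.pi fun _ : V => ν).real {ω | Fires G ω τ x (par x)} = fireProb r p η τ) :
    Branches ν y (kids G par y) (below h par) (fun x τ => {ω | Fires G ω τ x y})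
      (fireProb r p η) j := by
  have hkid : ∀ x ∈ kids G par y, h x = h y + 1 ∧ par x = y := fun x hx =>
    R.kid hy (mem_kids.1 hx).1 (mem_kids.1 hx).2
  refine ⟨fun x hx τ hτ => R.dependsOn_fires_kid (by omega) (mem_kids.1 hx).1 (mem_kids.1 hx).2,
    fun x hx x' hx' hne => disjoint_below ?_ hne, fun x hx => not_mem_below (hkid x hx).1,
    fun x hx τ hτ => ?_, fun x hx τ τ' hne => ?_⟩
  · rw [(hkid x hx).1, (hkid x' hx').1]
  · have := hlaw τ hτ x (by have := (hkid x hx).1; omega) (by have := (hkid x hx).1; omega)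
    rwa [(hkid x hx).2] at this
  · rw [Set.disjoint_left]
    exact fun ω h1 h2 => hne (Fires.unique h1 h2)

variable [IsProbabilityMeasure ν]

/-- By induction on the round, the $r-1$ branches at $y$ are independent with the same firing law,
and `Branches.prob_trigger` reproduces the recursion `fireProb_succ`. -/
lemma Rooting.prob_fires (R : Rooting G v g h par) (hdeg : ∀ y, (G.neighborSet y).ncard = r)
    (hr : 3 ≤ r) (hν : ∀ k, ν.real {k} = labelProb p η k) (i : ℕ) : ∀ y, 0 < h y → h y + i ≤ g →
      (Measure.pi fun _ : V => ν).real {ω | Fires G ω i y (par y)} = fireProb r p η i := by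
  induction i using Nat.strong_induction_on with
  | _ i ih =>
    intro y hy hyi
    rcases i with _ | i
    · have h1 : {ω : V → ℕ | Fires G ω 0 y (par y)} = {ω | ω y ∈ ({0} : Set ℕ)} := by
        ext ω
        simp [fires_zero_iff]
      rw [h1, measureReal_label, hν]
      rfl
    · have hB := R.branches (ν := ν) (r := r) (p := p) (η := η) (y := y) (j := i + 1) (by omega) hyi
        fun τ hτ => ih τ hτ
      have h1 : {ω : V → ℕ | Fires G ω (i + 1) y (par y)} = {ω | ∃ x ∈ kids G par y, ∃ τ < i + 1,
          ω ∈ {ω | Fires G ω τ x y} ∧ τ + ω y = i + 1 ∧ ∀ x' ∈ kids G par y, x' ≠ x →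
          ω ∈ silentSet (fun x τ => {ω | Fires G ω τ x y}) (i + 1) x'} := by
        ext ω
        simp only [Set.mem_ofPred_eq, mem_kids, silentSet]
        rw [fires_iff]
        constructor
        · rintro (⟨h1, -⟩ | ⟨h0, x, h1, h2, τ, hτ, h3, h4, h5⟩)
          · omega
          · exact ⟨x, ⟨h1, h2⟩, τ, hτ, h3, h4, fun x' a b => h5 x' a.1 a.2 b⟩
        · rintro ⟨x, ⟨h1, h2⟩, τ, hτ, h3, h4, h5⟩
          exact Or.inr ⟨by omega, x, h1, h2, τ, hτ, h3, h4, fun x' a b c => h5 x' ⟨a, b⟩ c⟩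
      rw [h1, hB.prob_trigger le_rfl, R.card_kids hdeg hy (by omega), fireProb_succ, silence_eq,
        Nat.cast_sub (by omega : 1 ≤ r), Nat.cast_one, show r - 1 - 1 = r - 2 by omega]
      simp only [hν]

lemma Rooting.branches_of_law (R : Rooting G v g h par) (hdeg : ∀ y, (G.neighborSet y).ncard = r)
    (hr : 3 ≤ r) (hν : ∀ k, ν.real {k} = labelProb p η k) {y : V} {j : ℕ} (hy : h y < g)
    (hyj : h y + j ≤ g) :
    Branches ν y (kids G par y) (below h par) (fun x τ => {ω | Fires G ω τ x y})
      (fireProb r p η) j :=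
  R.branches hy hyj fun τ _ => R.prob_fires hdeg hr hν τ

lemma prob_nonseed (hν : ∀ k, ν.real {k} = labelProb p η k) : ν.real {0}ᶜ = 1 - p := by
  rw [probReal_compl_eq_one_sub (MeasurableSet.singleton 0), hν]
  rfl

/-- A first-moment bound: each further vertex of the chain can be chosen in $r-1$ ways and costs
$(1-p)$ times the silence of $r-2$ branches, which is a factor $K$. -/
lemma Rooting.prob_whiteChain_le (R : Rooting G v g h par)
    (hdeg : ∀ y, (G.neighborSet y).ncard = r) (hr : 3 ≤ r)
    (hν : ∀ k, ν.real {k} = labelProb p η k) {N : ℕ} (hp : p < 1) (hs : 0 ≤ silence r p η N)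
    (k : ℕ) : ∀ y, 0 < h y → h y + k + (N + 1) ≤ g →
      (Measure.pi fun _ : V => ν).real {ω | WhiteChain G ω N par k y}
        ≤ branchRate r p (silence r p η N) ^ k := by
  induction k with
  | zero => intro y _ _; simp
  | succ k ih =>
    intro y hy hyk
    have hB := R.branches_of_law hdeg hr hν (y := y) (j := N + 1) (by omega) (by omega)
    have h1 : {ω : V → ℕ | WhiteChain G ω N par (k + 1) y} ⊆ ⋃ x ∈ kids G par y,
        ({ω : V → ℕ | ω y ∈ ({0}ᶜ : Set ℕ)} ∩ ({ω | WhiteChain G ω N par k x} ∩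
          {ω | ∀ x' ∈ kids G par y, x' ≠ x →
            ω ∈ silentSet (fun x τ => {ω | Fires G ω τ x y}) (N + 1) x'})) := by
      rintro ω ⟨h0, x, hx, h2, h3⟩
      refine Set.mem_biUnion (mem_kids.2 hx) ⟨h0, h2, fun x' hx' hne τ hτ => ?_⟩
      exact h3 x' (mem_kids.1 hx') hne τ hτ
    refine (measureReal_mono h1 (measure_ne_top _ _)).trans ((measureReal_biUnion_finset_le _ _).trans ?_)
    have h2 : ∀ x ∈ kids G par y, (Measure.pi fun _ : V => ν).real
        ({ω : V → ℕ | ω y ∈ ({0}ᶜ : Set ℕ)} ∩ ({ω | WhiteChain G ω N par k x} ∩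
          {ω | ∀ x' ∈ kids G par y, x' ≠ x →
            ω ∈ silentSet (fun x τ => {ω | Fires G ω τ x y}) (N + 1) x'}))
        ≤ (1 - p) * branchRate r p (silence r p η N) ^ k * silence r p η N ^ (r - 2) := by
      intro x hx
      have hkid := R.kid (by omega) (mem_kids.1 hx).1 (mem_kids.1 hx).2
      rw [hB.prob_single hx _ (R.dependsOn_whiteChain k x (by omega)), prob_nonseed hν,
        R.card_kids hdeg hy (by omega), ← silence_eq, show r - 1 - 1 = r - 2 by omega]
      have := ih x (by omega) (by omega)
      have : 0 ≤ 1 - p := by linarith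
      gcongr
    refine (Finset.sum_le_sum h2).trans (le_of_eq ?_)
    rw [Finset.sum_const, R.card_kids hdeg hy (by omega), nsmul_eq_mul,
      Nat.cast_sub (by omega : 1 ≤ r), pow_succ]
    simp only [branchRate]
    push_cast
    ring

/-- The law of the grown forest at a vertex with a tree-like neighbourhood. -/
theorem Rooting.prob_grownForest_ge (R : Rooting G v g h par)
    (hdeg : ∀ y, (G.neighborSet y).ncard = r) (hr : 3 ≤ r)
    (hν : ∀ k, ν.real {k} = labelProb p η k) {N l : ℕ} (hp : p < 1) (hs : 0 ≤ silence r p η N)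
    (hg : N + l + 2 ≤ g) :
    p * (1 - p) ^ r
      + (∑ i ∈ Finset.range N, r * ((1 - p) * η * pressure r p η i) * silence r p η (i + 1) ^ (r - 1)
        + (1 - p) * silence r p η N ^ r) - r * branchRate r p (silence r p η N) ^ l ≤
      (Measure.pi fun _ : V => ν).real {ω | v ∈ grownForest G ω N} := by
  have hv := R.root
  have hB : ∀ j ≤ N + 1, Branches ν v (kids G par v) (below h par)
      (fun x τ => {ω | Fires G ω τ x v}) (fireProb r p η) j := fun j hj =>
    R.branches_of_law hdeg hr hν (by omega) (by omega)
  have hcard := R.card_kids_root hdeg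
  have hkids : ∀ x, x ∈ kids G par v ↔ G.Adj v x := by
    intro x
    rw [mem_kids, R.par_root]
    exact ⟨fun h => h.1, fun h => ⟨h, h.ne'⟩⟩
  have hseed : (Measure.pi fun _ : V => ν).real {ω | PurpleAt G ω 0 v} = p * (1 - p) ^ r := by
    have h1 : {ω : V → ℕ | PurpleAt G ω 0 v} = {ω : V → ℕ | ω v ∈ ({0} : Set ℕ)} ∩
        {ω | ∀ x ∈ kids G par v, ω ∈ silentSet (fun x τ => {ω | Fires G ω τ x v}) 1 x} := by
      ext ω
      simp [PurpleAt, silentSet, hkids, fires_zero_iff]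
    rw [h1, (hB 1 (by omega)).prob_all_silent, hcard, hν]
    simp [labelProb, fireProb]
  have hpurple : ∀ i < N, (Measure.pi fun _ : V => ν).real {ω | PurpleAt G ω (i + 1) v} =
      r * ((1 - p) * η * pressure r p η i) * silence r p η (i + 1) ^ (r - 1) := by
    intro i hi
    -- A purple vertex also demands silence in its own round, hence `i + 2` for the other branches.
    have h1 : {ω : V → ℕ | PurpleAt G ω (i + 1) v} = {ω | ∃ x ∈ kids G par v, ∃ τ < i + 1,
        ω ∈ {ω | Fires G ω τ x v} ∧ τ + ω v = i + 1 ∧ ∀ x' ∈ kids G par v, x' ≠ x →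
        ω ∈ silentSet (fun x τ => {ω | Fires G ω τ x v}) (i + 2) x'} := by
      ext ω
      simp only [Set.mem_ofPred_eq, hkids, silentSet, PurpleAt]
      constructor
      · rintro (⟨h1, -⟩ | ⟨h0, x, h1, τ, hτ, h3, h4, h5⟩)
        · omega
        · exact ⟨x, h1, τ, hτ, h3, h4, fun x' a b τ' c => h5 x' a b τ' (by omega)⟩
      · rintro ⟨x, h1, τ, hτ, h3, h4, h5⟩
        exact Or.inr ⟨by omega, x, h1, τ, hτ, h3, h4, fun x' a b τ' c => h5 x' a b τ' (by omega)⟩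
    rw [h1, (hB (i + 2) (by omega)).prob_trigger (by omega), hcard, pressure_eq, silence_eq]
    simp only [hν]
  have hwhite : (Measure.pi fun _ : V => ν).real {ω | White G ω N v} =
      (1 - p) * silence r p η N ^ r := by
    have h1 : {ω : V → ℕ | White G ω N v} = {ω : V → ℕ | ω v ∈ ({0}ᶜ : Set ℕ)} ∩
        {ω | ∀ x ∈ kids G par v, ω ∈ silentSet (fun x τ => {ω | Fires G ω τ x v}) (N + 1) x} := by
      ext ω
      simp [White, silentSet, hkids]
    rw [h1, (hB (N + 1) le_rfl).prob_all_silent, hcard, prob_nonseed hν, silence_eq]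
  have hbad : (Measure.pi fun _ : V => ν).real (⋃ x ∈ kids G par v,
      {ω | WhiteChain G ω N par l x}) ≤ r * branchRate r p (silence r p η N) ^ l := by
    refine (measureReal_biUnion_finset_le _ _).trans ?_
    rw [← hcard, ← nsmul_eq_mul]
    refine Finset.sum_le_card_nsmul _ _ _ fun x hx => ?_
    have := (R.kid (by omega) (mem_kids.1 hx).1 (mem_kids.1 hx).2).1
    rw [hcard]
    exact R.prob_whiteChain_le hdeg hr hν hp hs l x (by omega) (by omega)
  have hunion : (Measure.pi fun _ : V => ν).real
      ((⋃ i ∈ Finset.range (N + 1), {ω | PurpleAt G ω i v}) ∪ {ω | White G ω N v}) =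
      p * (1 - p) ^ r + (∑ i ∈ Finset.range N, r * ((1 - p) * η * pressure r p η i)
        * silence r p η (i + 1) ^ (r - 1) + (1 - p) * silence r p η N ^ r) := by
    rw [measureReal_union _ (measurableSet_labels _) (measure_ne_top _ _) (measure_ne_top _ _),
      measureReal_biUnion_finset,
      Finset.sum_range_succ', hseed, hwhite, Finset.sum_congr rfl fun i hi =>
        hpurple i (Finset.mem_range.1 hi)]
    · ring
    · intro i _ j _ hij
      rw [Function.onFun, Set.disjoint_left]
      exact fun ω h1 h2 => hij (PurpleAt.unique h1 h2)
    · exact fun _ _ => measurableSet_labels _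
    · rw [Set.disjoint_left]
      intro ω h1 h2
      obtain ⟨i, hi, h3⟩ := Set.mem_iUnion₂.1 h1
      exact White.not_purple h2 (by simpa [Nat.lt_succ_iff] using hi) h3
  -- A white vertex that is not in the forest lies in a white set without a leaf, and a white chain
  -- of length `l` then starts at one of its children.
  have hsub : (⋃ i ∈ Finset.range (N + 1), {ω | PurpleAt G ω i v}) ∪ {ω | White G ω N v} ⊆
      {ω | v ∈ grownForest G ω N} ∪ ⋃ x ∈ kids G par v, {ω | WhiteChain G ω N par l x} := by
    rintro ω (h1 | h1)
    · obtain ⟨i, hi, h3⟩ := Set.mem_iUnion₂.1 h1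
      exact Or.inl (Or.inl ⟨i, by simpa [Nat.lt_succ_iff] using hi, h3⟩)
    · by_cases h2 : ∀ T : Finset V, v ∈ T → (∀ x ∈ T, White G ω N x) → HasLeaf G T
      · exact Or.inl (Or.inr ⟨h1, h2⟩)
      · push Not at h2
        obtain ⟨T, hvT, hT, hleaf⟩ := h2
        obtain ⟨-, x, hx, h3, -⟩ := R.whiteChain_of_not_hasLeaf hT hleaf (l + 1) v hvT (by omega)
        exact Or.inr (Set.mem_biUnion (mem_kids.2 hx) h3)
  have := (measureReal_mono (μ := Measure.pi fun _ : V => ν) hsub (measure_ne_top _ _)).trans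
    (measureReal_union_le _ _)
  linarith

end


/-! ### Small dense sets and tree-like balls. -/

section

variable {V : Type*}

/-- `S` spans at least as many edges of `G` as it has vertices. -/
def IsDense (G : SimpleGraph V) (S : Finset V) : Prop :=
  ∃ E : Finset (Sym2 V), E.card = S.card ∧ ∀ e ∈ E, e ∈ G.edgeSet ∧ ∀ x ∈ e, x ∈ S

/-- The vertices in a dense set with at most `k` elements. -/
def badVertices (G : SimpleGraph V) (k : ℕ) : Set V :=
  {v | ∃ S : Finset V, v ∈ S ∧ S.card ≤ k ∧ IsDense G S}

lemma exists_adj_dist {G : SimpleGraph V} {v z : V} (hz : G.Reachable v z) (hne : z ≠ v) :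
    ∃ w, G.Adj z w ∧ G.Reachable v w ∧ G.dist v w + 1 = G.dist v z := by
  obtain ⟨q, hq⟩ := hz.symm.exists_walk_length_eq_dist
  cases q with
  | nil => exact absurd rfl hne
  | @cons _ w _ hadj q =>
    refine ⟨w, hadj, q.reachable.symm, ?_⟩
    have h1 := SimpleGraph.dist_le q
    rw [SimpleGraph.Walk.length_cons] at hq
    have h2 : G.dist z v ≤ 1 + G.dist w v := by
      obtain ⟨q', hq'⟩ := q.reachable.exists_walk_length_eq_dist
      have := SimpleGraph.dist_le (SimpleGraph.Walk.cons hadj q')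
      rw [SimpleGraph.Walk.length_cons] at this
      omega
    rw [SimpleGraph.dist_comm (u := v) (v := w), SimpleGraph.dist_comm (u := v) (v := z)]
    omega

/-- Around a vertex in no small dense set the graph is a tree. -/
theorem exists_rooting {G : SimpleGraph V} {v : V} {g : ℕ} (hv : v ∉ badVertices G (2 * (g + 1))) :
    ∃ h par, Rooting G v g h par := by
  classical
  have hex : ∀ z, ∃ w, (z = v → w = v) ∧ (G.Reachable v z → z ≠ v →
      G.Adj z w ∧ G.Reachable v w ∧ G.dist v w + 1 = G.dist v z) := by
    intro z
    by_cases hz : G.Reachable v z ∧ z ≠ v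
    · obtain ⟨w, hw⟩ := exists_adj_dist hz.1 hz.2
      exact ⟨w, fun h => absurd h hz.2, fun _ _ => hw⟩
    · exact ⟨v, fun _ => rfl, fun h1 h2 => absurd ⟨h1, h2⟩ hz⟩
  choose par hpar hpar' using hex
  -- Unreachable vertices get height `g + 1`, outside the ball, instead of the default distance `0`.
  set h : V → ℕ := fun z => if G.Reachable v z then G.dist v z else g + 1 with hh
  have hreach : ∀ z, h z ≤ g → G.Reachable v z ∧ h z = G.dist v z := by
    intro z hz
    by_cases h1 : G.Reachable v z
    · exact ⟨h1, if_pos h1⟩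
    · simp only [hh, if_neg h1] at hz
      omega
  have hval : ∀ z, G.Reachable v z → h z = G.dist v z := fun z hz => if_pos hz
  have hstep : ∀ z, h z ≤ g → z ≠ v → G.Adj z (par z) ∧ h (par z) + 1 = h z := by
    intro z hz hne
    obtain ⟨h1, h2⟩ := hreach z hz
    obtain ⟨h3, h4, h5⟩ := hpar' z h1 hne
    exact ⟨h3, by rw [hval _ h4, h2, h5]⟩
  have hroot : h v = 0 := by rw [hval v (SimpleGraph.Reachable.refl v), SimpleGraph.dist_self]
  have hiter : ∀ j z, h z ≤ g → h (par^[j] z) + j ≤ g ∨ par^[j] z = v := by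
    intro j
    induction j with
    | zero => intro z hz; exact Or.inl hz
    | succ j ih =>
      intro z hz
      rw [Function.iterate_succ_apply']
      rcases ih z hz with h1 | h1
      · by_cases h2 : par^[j] z = v
        · right; rw [h2, hpar v rfl]
        · left
          have := (hstep _ (by omega) h2).2
          omega
      · right; rw [h1, hpar v rfl]
  refine ⟨h, par, hroot, hpar v rfl, fun z w hz hzw => ?_, fun z hz hzg => ?_⟩
  swap
  · refine (hstep z hzg ?_).1
    rintro rfl
    omega
  by_contra hno
  push Not at hno
  have hz' := hreach z hz.le
  have hwr : G.Reachable v w := hz'.1.trans hzw.reachable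
  have hw : h w ≤ g := by
    obtain ⟨q, hq⟩ := hz'.1.exists_walk_length_eq_dist
    have := SimpleGraph.dist_le (q.concat hzw)
    rw [SimpleGraph.Walk.length_concat] at this
    rw [hval w hwr]
    omega
  -- An edge `zw` that is not a parent edge closes a cycle: the two paths of ancestors up to `v`
  -- carry $|S|-1$ parent edges, and `zw` is one more.
  set S : Finset V := (Finset.range (g + 1)).image (fun j => par^[j] z) ∪
    (Finset.range (g + 1)).image (fun j => par^[j] w) with hS
  have hend : ∀ y, h y ≤ g → par^[g] y = v := by
    intro y hy
    rcases hiter g y hy with h1 | h1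
    · by_contra hne
      have := (hstep _ (by omega) hne).2
      omega
    · exact h1
  have hchain : ∀ y, h y ≤ g → ∀ u ∈ (Finset.range (g + 1)).image (fun j => par^[j] y),
      h u ≤ g ∧ par u ∈ (Finset.range (g + 1)).image (fun j => par^[j] y) := by
    intro y hy u hu
    obtain ⟨j, hj, rfl⟩ := Finset.mem_image.1 hu
    rw [Finset.mem_range] at hj
    constructor
    · rcases hiter j y hy with h1 | h1
      · omega
      · simp only [h1, hroot]; omega
    · by_cases hjg : j = g
      · subst hjg
        refine Finset.mem_image.2 ⟨j, by simp, ?_⟩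
        simp only [hend y hy, hpar v rfl]
      · refine Finset.mem_image.2 ⟨j + 1, by simp; omega, ?_⟩
        exact Function.iterate_succ_apply' par j y
  have hSpar : ∀ u ∈ S, h u ≤ g ∧ par u ∈ S := by
    intro u hu
    rcases Finset.mem_union.1 hu with h1 | h1
    · exact ⟨(hchain z hz.le u h1).1, Finset.mem_union_left _ (hchain z hz.le u h1).2⟩
    · exact ⟨(hchain w hw u h1).1, Finset.mem_union_right _ (hchain w hw u h1).2⟩
  have hself : ∀ y, y ∈ (Finset.range (g + 1)).image (fun j => par^[j] y) := fun y =>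
    Finset.mem_image.2 ⟨0, by simp, rfl⟩
  have hzS : z ∈ S := Finset.mem_union_left _ (hself z)
  have hwS : w ∈ S := Finset.mem_union_right _ (hself w)
  have hvS : v ∈ S := Finset.mem_union_left _ (Finset.mem_image.2 ⟨g, by simp, hend z hz.le⟩)
  have hup : ∀ u ∈ S.erase v, G.Adj u (par u) ∧ h (par u) + 1 = h u := fun u hu =>
    hstep u (hSpar u (Finset.mem_of_mem_erase hu)).1 (Finset.ne_of_mem_erase hu)
  refine hv ⟨S, hvS, ?_, insert s(z, w) ((S.erase v).image fun u => s(u, par u)), ?_, ?_⟩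
  · refine (Finset.card_union_le _ _).trans ?_
    have h1 := Finset.card_image_le (s := Finset.range (g + 1)) (f := fun j => par^[j] z)
    have h2 := Finset.card_image_le (s := Finset.range (g + 1)) (f := fun j => par^[j] w)
    rw [Finset.card_range] at h1 h2
    omega
  · rw [Finset.card_insert_of_notMem, Finset.card_image_of_injOn, Finset.card_erase_of_mem hvS]
    · have := Finset.card_pos.2 ⟨v, hvS⟩
      omega
    · intro u hu u' hu' he
      have h1 := (hup u hu).2
      have h2 := (hup u' hu').2
      rcases Sym2.eq_iff.1 he with ⟨h3, -⟩ | ⟨h3, h4⟩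
      · exact h3
      · rw [h4] at h1
        rw [← h3] at h2
        omega
    · intro hmem
      obtain ⟨u, hu, he⟩ := Finset.mem_image.1 hmem
      have h1 := (hup u hu).2
      rcases Sym2.eq_iff.1 he with ⟨h3, h4⟩ | ⟨h3, h4⟩
      · subst h3
        rw [h4] at h1
        exact hno.2 h1.symm h4
      · subst h3
        rw [h4] at h1
        exact hno.1 h1.symm h4
  · intro e he
    rcases Finset.mem_insert.1 he with rfl | he
    · refine ⟨hzw, fun x hx => ?_⟩
      rcases Sym2.mem_iff.1 hx with rfl | rfl
      · exact hzS
      · exact hwS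
    · obtain ⟨u, hu, rfl⟩ := Finset.mem_image.1 he
      refine ⟨(hup u hu).1, fun x hx => ?_⟩
      rcases Sym2.mem_iff.1 hx with rfl | rfl
      · exact Finset.mem_of_mem_erase hu
      · exact (hSpar u (Finset.mem_of_mem_erase hu)).2

end

/-! ### From the mean over the labels to a large forest. -/

lemma exists_labelMeasure {p η : ℝ} (hp0 : 0 < p) (hp : p < 1) (hη : 0 < η) (hη1 : η < 1) :
    ∃ ν : Measure ℕ, IsProbabilityMeasure ν ∧ ∀ k, ν.real {k} = labelProb p η k := by
  have hnn : ∀ k, 0 ≤ labelProb p η k := by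
    intro k
    cases k with
    | zero => exact hp0.le
    | succ k =>
      have : 0 < 1 - p := by linarith
      have : 0 < 1 - η := by linarith
      simp only [labelProb]
      positivity
  have hsum : HasSum (labelProb p η) 1 := by
    rw [← hasSum_nat_add_iff' 1]
    have h1 := (hasSum_geometric_of_lt_one (by linarith : 0 ≤ 1 - η) (by linarith)).mul_left
      ((1 - p) * η)
    have h2 : (1 - p) * η * (1 - (1 - η))⁻¹ = 1 - ∑ i ∈ Finset.range 1, labelProb p η i := by
      simp [labelProb, hη.ne']
    rw [h2] at h1
    exact h1
  have hsum' : HasSum (fun k => ENNReal.ofReal (labelProb p η k)) 1 := by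
    rw [← ENNReal.ofReal_one, ← hsum.tsum_eq, ENNReal.ofReal_tsum_of_nonneg hnn hsum.summable]
    exact ENNReal.summable.hasSum
  let P : PMF ℕ := ⟨fun k => ENNReal.ofReal (labelProb p η k), hsum'⟩
  refine ⟨P.toMeasure, inferInstance, fun k => ?_⟩
  rw [Measure.real, P.toMeasure_apply_singleton k (MeasurableSet.singleton k)]
  exact ENNReal.toReal_ofReal (hnn k)

open Classical in
/-- A regular graph in which few vertices lie in small dense sets has a large induced forest. -/
theorem exists_large_forest {r : ℕ} {p α : ℝ} (hα : IsStop r p α) (hr : 3 ≤ r) (hp0 : 0 < p)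
    (hp : p < 1) {ε : ℝ} (hε : 0 < ε) : ∃ k : ℕ, ∀ (n : ℕ) (G : SimpleGraph (Fin n)),
      (∀ y, (G.neighborSet y).ncard = r) → ((badVertices G k).ncard : ℝ) ≤ ε * n →
      HasInducedForest G ((p * (1 - p) ^ r + forestGain r p α - 5 * ε) * n) := by
  have hr3 : (3 : ℝ) ≤ r := by exact_mod_cast hr
  obtain ⟨η, N, hη, hη', hK, hgain⟩ := exists_rounds hα hr hp0 hp hε
  have hη1 : η < 1 := by nlinarith
  have hs : 0 < silence r p η N := (round_invariant hr hp0 hp hη hη' N).1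
  have hK0 := branchRate_pos hr hp hs
  obtain ⟨ν, hνp, hν⟩ := exists_labelMeasure hp0 hp hη hη1
  obtain ⟨l, hl⟩ : ∃ l : ℕ, r * branchRate r p (silence r p η N) ^ l < ε := by
    obtain ⟨l, hl⟩ := exists_pow_lt_of_lt_one (show 0 < ε / r by positivity) hK
    refine ⟨l, ?_⟩
    rw [lt_div_iff₀ (by linarith)] at hl
    linarith
  refine ⟨2 * (N + l + 2 + 1), fun n G hdeg hbad => ?_⟩
  set T : ℝ := p * (1 - p) ^ r + forestGain r p α with hT
  have hT3 : T ≤ 3 := hα.value_le_three hr hp0 hp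
  set μ := Measure.pi fun _ : Fin n => ν with hμ
  set B := badVertices G (2 * (N + l + 2 + 1)) with hB
  -- One `ε` is lost to the discretization and one to white chains. A bad vertex loses at most `3`
  -- by `value_le_three`, so the bad vertices account for the other `3 * ε`.
  have hgood : ∀ v : Fin n, T - 2 * ε - (if v ∈ B then 3 else 0) ≤
      μ.real {ω | v ∈ grownForest G ω N} := by
    intro v
    by_cases hv : v ∈ B
    · rw [if_pos hv]
      have := measureReal_nonneg (μ := μ) (s := {ω | v ∈ grownForest G ω N})
      linarith
    · rw [if_neg hv]
      obtain ⟨h, par, R⟩ := exists_rooting hv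
      have := R.prob_grownForest_ge hdeg hr hν (l := l) hp hs.le le_rfl
      linarith
  have hintegrable : ∀ v : Fin n, Integrable
      (fun ω : Fin n → ℕ => {ω | v ∈ grownForest G ω N}.indicator (1 : (Fin n → ℕ) → ℝ) ω) μ :=
    fun v => (integrable_const (1 : ℝ)).indicator (measurableSet_labels _)
  -- Some labelling does at least as well as the mean size of the forest.
  obtain ⟨ω, hω⟩ := exists_integral_le (μ := μ) (integrable_finsetSum Finset.univ fun v _ => hintegrable v)
  rw [integral_finsetSum _ fun v _ => hintegrable v] at hω
  simp only [integral_indicator_one (measurableSet_labels _)] at hω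
  have hsum := (Finset.sum_le_sum fun v (_ : v ∈ Finset.univ) => hgood v).trans hω
  rw [Finset.sum_sub_distrib, Finset.sum_const, Finset.card_univ, Fintype.card_fin, nsmul_eq_mul,
    ← Finset.sum_filter, Finset.sum_const, nsmul_eq_mul] at hsum
  have hBc : ((Finset.univ.filter fun v => v ∈ B).card : ℝ) ≤ ε * n := by
    refine le_trans (le_of_eq ?_) hbad
    rw [← Set.ncard_coe_finset]
    simp
  refine ⟨Finset.univ.filter fun v => v ∈ grownForest G ω N, ?_, ?_⟩
  · have h1 : ((Finset.univ.filter fun v => v ∈ grownForest G ω N : Finset (Fin n)) : Set (Fin n)) =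
        grownForest G ω N := by
      ext v
      simp
    rw [h1]
    exact isAcyclic_grownForest
  · have : ((Finset.univ.filter fun v => v ∈ grownForest G ω N).card : ℝ) =
        ∑ v, {ω | v ∈ grownForest G ω N}.indicator (1 : (Fin n → ℕ) → ℝ) ω := by
      rw [Finset.card_filter]
      push_cast
      refine Finset.sum_congr rfl fun v _ => ?_
      simp [Set.indicator_apply]
    rw [this]
    linarith


/-! ### Switchings in regular graphs. -/

section

variable {V : Type*}

/-- The graph obtained from `G` by replacing the edges `uv`, `xy` with `ux`, `vy`. -/
def switchGraph (G : SimpleGraph V) (u v x y : V) : SimpleGraph V :=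
  SimpleGraph.fromEdgeSet ((G.edgeSet \ {s(u, v), s(x, y)}) ∪ {s(u, x), s(v, y)})

/-- The conditions under which `uv`, `xy` can be switched to `ux`, `vy`. -/
structure Switchable (G : SimpleGraph V) (u v x y : V) : Prop where
  uv : G.Adj u v
  xy : G.Adj x y
  xu : x ≠ u
  yv : y ≠ v
  nux : ¬ G.Adj u x
  nvy : ¬ G.Adj v y

variable {G : SimpleGraph V} {u v x y : V}

lemma Switchable.edgeSet_switchGraph (h : Switchable G u v x y) :
    (switchGraph G u v x y).edgeSet = (G.edgeSet \ {s(u, v), s(x, y)}) ∪ {s(u, x), s(v, y)} := by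
  rw [switchGraph, SimpleGraph.edgeSet_fromEdgeSet, sdiff_eq_left, Set.disjoint_left]
  rintro e (he | rfl | rfl) hd
  · exact G.not_isDiag_of_mem_edgeSet he.1 hd
  · exact h.xu (Sym2.mk_isDiag_iff.1 hd).symm
  · exact h.yv (Sym2.mk_isDiag_iff.1 hd).symm

/-- The switching can be undone once `x` and `y` are known, which makes the double count below
injective. -/
lemma Switchable.edgeSet_eq (h : Switchable G u v x y) :
    G.edgeSet = ((switchGraph G u v x y).edgeSet \ {s(u, x), s(v, y)}) ∪ {s(u, v), s(x, y)} := by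
  rw [h.edgeSet_switchGraph]
  have h1 : s(u, v) ∈ G.edgeSet := h.uv
  have h2 : s(x, y) ∈ G.edgeSet := h.xy
  have h3 : s(u, x) ∉ G.edgeSet := h.nux
  have h4 : s(v, y) ∉ G.edgeSet := h.nvy
  ext e
  simp only [Set.mem_union, Set.mem_sdiff, Set.mem_insert_iff, Set.mem_singleton_iff]
  constructor
  · intro he
    have h5 : e ≠ s(u, x) := fun h => h3 (h ▸ he)
    have h6 : e ≠ s(v, y) := fun h => h4 (h ▸ he)
    tauto
  · rintro (⟨⟨he, -⟩ | h5, h6⟩ | rfl | rfl)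
    · exact he
    · exact absurd h5 h6
    · exact h1
    · exact h2

lemma Switchable.adj_switchGraph (h : Switchable G u v x y) (a b : V) :
    (switchGraph G u v x y).Adj a b ↔
      (G.Adj a b ∧ s(a, b) ≠ s(u, v) ∧ s(a, b) ≠ s(x, y)) ∨ s(a, b) = s(u, x) ∨
        s(a, b) = s(v, y) := by
  rw [← SimpleGraph.mem_edgeSet, h.edgeSet_switchGraph]
  simp only [Set.mem_union, Set.mem_sdiff, Set.mem_insert_iff, Set.mem_singleton_iff, not_or,
    SimpleGraph.mem_edgeSet]

/-- Switching preserves degrees. -/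
lemma Switchable.ncard_neighborSet (h : Switchable G u v x y) (a : V) [Finite V] :
    ((switchGraph G u v x y).neighborSet a).ncard = (G.neighborSet a).ncard := by
  obtain ⟨huv, hxy, hxu, hyv, hux, hvy⟩ := h
  have h : Switchable G u v x y := ⟨huv, hxy, hxu, hyv, hux, hvy⟩
  have nuv : u ≠ v := huv.ne
  have nxy : x ≠ y := hxy.ne
  have nxv : x ≠ v := by rintro rfl; exact hux huv
  have nyu : y ≠ u := by rintro rfl; exact hvy huv.symm
  by_cases hu : a = u
  · subst hu
    have : (switchGraph G a v x y).neighborSet a = insert x (G.neighborSet a \ {v}) := by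
      ext b
      simp only [SimpleGraph.mem_neighborSet, h.adj_switchGraph, Set.mem_insert_iff, Set.mem_sdiff,
        Set.mem_singleton_iff, ne_eq, Sym2.eq_iff]
      grind
    rw [this, Set.ncard_exchange (s := G.neighborSet a) hux huv]
  by_cases hv : a = v
  · subst hv
    have : (switchGraph G u a x y).neighborSet a = insert y (G.neighborSet a \ {u}) := by
      ext b
      simp only [SimpleGraph.mem_neighborSet, h.adj_switchGraph, Set.mem_insert_iff, Set.mem_sdiff,
        Set.mem_singleton_iff, ne_eq, Sym2.eq_iff]
      grind
    rw [this, Set.ncard_exchange (s := G.neighborSet a) hvy huv.symm]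
  by_cases hx : a = x
  · subst hx
    have : (switchGraph G u v a y).neighborSet a = insert u (G.neighborSet a \ {y}) := by
      ext b
      simp only [SimpleGraph.mem_neighborSet, h.adj_switchGraph, Set.mem_insert_iff, Set.mem_sdiff,
        Set.mem_singleton_iff, ne_eq, Sym2.eq_iff]
      grind
    rw [this, Set.ncard_exchange (s := G.neighborSet a) (fun h' => hux (SimpleGraph.Adj.symm h')) hxy]
  by_cases hy : a = y
  · subst hy
    have : (switchGraph G u v x a).neighborSet a = insert v (G.neighborSet a \ {x}) := by
      ext b
      simp only [SimpleGraph.mem_neighborSet, h.adj_switchGraph, Set.mem_insert_iff, Set.mem_sdiff,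
        Set.mem_singleton_iff, ne_eq, Sym2.eq_iff]
      grind
    rw [this, Set.ncard_exchange (s := G.neighborSet a) (fun h' => hvy (SimpleGraph.Adj.symm h')) hxy.symm]
  · congr 1
    ext b
    simp only [SimpleGraph.mem_neighborSet, h.adj_switchGraph, ne_eq, Sym2.eq_iff]
    grind

variable [Fintype V]

open Classical in
/-- The `r`-regular graphs that contain all edges in `H`. -/
def regularWith (V : Type*) [Fintype V] (r : ℕ) (H : Finset (Sym2 V)) :
    Finset (SimpleGraph V) :=
  Finset.univ.filter fun G => (∀ a, (G.neighborSet a).ncard = r) ∧ ∀ e ∈ H, e ∈ G.edgeSet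

lemma mem_regularWith {r : ℕ} {H : Finset (Sym2 V)} : G ∈ regularWith V r H ↔
    (∀ a, (G.neighborSet a).ncard = r) ∧ ∀ e ∈ H, e ∈ G.edgeSet := by
  simp [regularWith]

open Classical in
/-- The number of ways to switch `uv` with an edge that starts outside `S`. -/
lemma card_switchable_ge {r k : ℕ} (hdeg : ∀ a, (G.neighborSet a).ncard = r) (huv : G.Adj u v)
    {S : Finset V} (hS : S.card ≤ k) : r * Fintype.card V ≤
      (Finset.univ.filter fun q : V × V => Switchable G u v q.1 q.2 ∧ q.1 ∉ S).card
        + r * (k + 2 * r + 2) := by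
  have hdeg' : ∀ a, (Finset.univ.filter fun b => G.Adj a b).card = r := by
    intro a
    rw [← hdeg a, ← Set.ncard_coe_finset]
    congr 1
    ext b
    simp
  have hfiber : ∀ A : Finset V, ((A ×ˢ (Finset.univ : Finset V)).filter
      fun q : V × V => G.Adj q.1 q.2).card = r * A.card := by
    intro A
    rw [Finset.card_filter, Finset.sum_product]
    simp only [← Finset.card_filter, hdeg']
    rw [Finset.sum_const, smul_eq_mul, mul_comm]
  have hfiber' : ∀ A : Finset V, (((Finset.univ : Finset V) ×ˢ A).filter
      fun q : V × V => G.Adj q.1 q.2).card = r * A.card := by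
    intro A
    rw [Finset.card_filter, Finset.sum_product_right]
    have : ∀ b, (Finset.univ.filter fun a => G.Adj a b).card = r := by
      intro b
      rw [← hdeg' b]
      congr 1
      ext a
      simp [G.adj_comm]
    simp only [← Finset.card_filter, this]
    rw [Finset.sum_const, smul_eq_mul, mul_comm]
  -- An oriented edge `(a, b)` fails only if `a` lies in `S`, equals `u` or is adjacent to `u`, or
  -- `b` equals `v` or is adjacent to `v`.
  have hcover : ((Finset.univ : Finset V) ×ˢ (Finset.univ : Finset V)).filter
        (fun q : V × V => G.Adj q.1 q.2) ⊆
      (Finset.univ.filter fun q : V × V => Switchable G u v q.1 q.2 ∧ q.1 ∉ S) ∪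
      (((S ∪ insert u (Finset.univ.filter fun b => G.Adj u b)) ×ˢ Finset.univ).filter
        (fun q : V × V => G.Adj q.1 q.2) ∪
      (Finset.univ ×ˢ (insert v (Finset.univ.filter fun b => G.Adj v b))).filter
        (fun q : V × V => G.Adj q.1 q.2)) := by
    rintro ⟨a, b⟩ hq
    have hab : G.Adj a b := (Finset.mem_filter.1 hq).2
    by_cases h1 : a ∈ S ∪ insert u (Finset.univ.filter fun b => G.Adj u b)
    · refine Finset.mem_union_right _ (Finset.mem_union_left _ (Finset.mem_filter.2 ⟨?_, hab⟩))
      exact Finset.mem_product.2 ⟨h1, Finset.mem_univ _⟩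
    by_cases h2 : b ∈ insert v (Finset.univ.filter fun b => G.Adj v b)
    · refine Finset.mem_union_right _ (Finset.mem_union_right _ (Finset.mem_filter.2 ⟨?_, hab⟩))
      exact Finset.mem_product.2 ⟨Finset.mem_univ _, h2⟩
    · simp only [Finset.mem_union, Finset.mem_insert, Finset.mem_filter, Finset.mem_univ, true_and,
        not_or] at h1 h2
      refine Finset.mem_union_left _ (Finset.mem_filter.2 ⟨Finset.mem_univ _, ?_, h1.1⟩)
      exact ⟨huv, hab, h1.2.1, h2.1, h1.2.2, h2.2⟩
  have h1 := (Finset.card_le_card hcover).trans ((Finset.card_union_le _ _).trans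
    (Nat.add_le_add_left (Finset.card_union_le _ _) _))
  rw [hfiber, hfiber, hfiber', Finset.card_univ] at h1
  have h2 : (S ∪ insert u (Finset.univ.filter fun b => G.Adj u b)).card ≤ k + (r + 1) := by
    refine (Finset.card_union_le _ _).trans (Nat.add_le_add hS ?_)
    refine (Finset.card_insert_le _ _).trans ?_
    rw [hdeg']
  have h3 : (insert v (Finset.univ.filter fun b => G.Adj v b)).card ≤ r + 1 := by
    refine (Finset.card_insert_le _ _).trans ?_
    rw [hdeg']
  have h4 := Nat.mul_le_mul_left r h2
  have h5 := Nat.mul_le_mul_left r h3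
  have h6 : r * (k + 2 * r + 2) = r * (k + (r + 1)) + r * (r + 1) := by ring
  omega

open Classical in
/-- One step of the switching argument. -/
lemma card_regularWith_insert {r k : ℕ} {S : Finset V} (hS : S.card ≤ k) {H : Finset (Sym2 V)}
    (hH : ∀ e ∈ H, ∀ x ∈ e, x ∈ S) {e : Sym2 V} (he : e ∉ H) :
    (regularWith V r (insert e H)).card * (r * Fintype.card V - r * (k + 2 * r + 2)) ≤
      (regularWith V r H).card * r ^ 2 := by
  induction e using Sym2.ind with
  | _ u v =>
  -- Double counting: a graph containing `uv` has many switchings away from it. The result keeps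
  -- `H`, since `x` lies outside `S`, and is recovered from one of the at most $r^2$ pairs of
  -- neighbours of `u` and `v`.
  set A := (regularWith V r (insert s(u, v) H)).sigma fun G =>
    Finset.univ.filter fun q : V × V => Switchable G u v q.1 q.2 ∧ q.1 ∉ S with hA
  set B := (regularWith V r H).sigma fun G =>
    (Finset.univ.filter fun b => G.Adj u b) ×ˢ (Finset.univ.filter fun b => G.Adj v b) with hB
  have hdeg' : ∀ G ∈ regularWith V r H, ∀ a, (Finset.univ.filter fun b => G.Adj a b).card = r := by
    intro G hG a
    rw [← (mem_regularWith.1 hG).1 a, ← Set.ncard_coe_finset]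
    congr 1
    ext b
    simp
  have hBc : B.card = (regularWith V r H).card * r ^ 2 := by
    rw [hB, Finset.card_sigma, Finset.sum_congr rfl fun G hG => by
      rw [Finset.card_product, hdeg' G hG, hdeg' G hG], Finset.sum_const, smul_eq_mul, sq]
  have hAc : (regularWith V r (insert s(u, v) H)).card *
      (r * Fintype.card V - r * (k + 2 * r + 2)) ≤ A.card := by
    rw [hA, Finset.card_sigma, ← smul_eq_mul]
    refine Finset.card_nsmul_le_sum _ _ _ fun G hG => ?_
    obtain ⟨h1, h2⟩ := mem_regularWith.1 hG
    have := card_switchable_ge h1 (u := u) (v := v) (h2 _ (Finset.mem_insert_self _ _)) hS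
    omega
  rw [← hBc]
  refine hAc.trans (Finset.card_le_card_of_injOn
    (fun z => ⟨switchGraph z.1 u v z.2.1 z.2.2, z.2⟩) ?_ ?_)
  · rintro ⟨G, x, y⟩ hz
    obtain ⟨hG, hq⟩ := Finset.mem_sigma.1 hz
    obtain ⟨hG1, hG2⟩ := mem_regularWith.1 hG
    obtain ⟨-, hsw, hxS⟩ := Finset.mem_filter.1 hq
    refine Finset.mem_sigma.2 ⟨mem_regularWith.2 ⟨fun a => ?_, fun e heH => ?_⟩, ?_⟩
    · rw [hsw.ncard_neighborSet, hG1]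
    · simp only [hsw.edgeSet_switchGraph]
      refine Or.inl ⟨hG2 e (Finset.mem_insert_of_mem heH), ?_⟩
      rintro (rfl | rfl)
      · exact he heH
      · exact hxS (hH _ heH _ (Sym2.mem_mk_left _ _))
    · refine Finset.mem_product.2 ⟨?_, ?_⟩
      · simp only [Finset.mem_filter, Finset.mem_univ, true_and, hsw.adj_switchGraph]
        exact Or.inr (Or.inl trivial)
      · simp only [Finset.mem_filter, Finset.mem_univ, true_and, hsw.adj_switchGraph]
        exact Or.inr (Or.inr trivial)
  · rintro ⟨G, x, y⟩ hz ⟨G', x', y'⟩ hz' heq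
    simp only [Sigma.mk.injEq, heq_eq_eq, Prod.mk.injEq] at heq
    obtain ⟨h1, rfl, rfl⟩ := heq
    have hs := (Finset.mem_filter.1 (Finset.mem_sigma.1 hz).2).2.1
    have hs' := (Finset.mem_filter.1 (Finset.mem_sigma.1 hz').2).2.1
    have : G = G' := by
      rw [← SimpleGraph.edgeSet_inj, hs.edgeSet_eq, hs'.edgeSet_eq]
      simp only at h1 ⊢
      rw [h1]
    rw [this]

/-- A given set of `m` edges is contained in few regular graphs. -/
lemma card_regularWith_le {r k : ℕ} {S : Finset V} (hS : S.card ≤ k) (H : Finset (Sym2 V)) :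
    (∀ e ∈ H, ∀ x ∈ e, x ∈ S) →
    (regularWith V r H).card * (r * Fintype.card V - r * (k + 2 * r + 2)) ^ H.card ≤
      (regularWith V r ∅).card * (r ^ 2) ^ H.card := by
  classical
  induction H using Finset.induction_on with
  | empty => simp
  | insert e H he ih =>
    intro hH
    have hH' : ∀ e ∈ H, ∀ x ∈ e, x ∈ S := fun e he => hH e (Finset.mem_insert_of_mem he)
    rw [Finset.card_insert_of_notMem he, pow_succ, pow_succ]
    have h1 := card_regularWith_insert (r := r) hS hH' he
    set M := r * Fintype.card V - r * (k + 2 * r + 2)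
    calc (regularWith V r (insert e H)).card * (M ^ H.card * M)
        = ((regularWith V r (insert e H)).card * M) * M ^ H.card := by ring
      _ ≤ ((regularWith V r H).card * r ^ 2) * M ^ H.card := Nat.mul_le_mul_right _ h1
      _ = ((regularWith V r H).card * M ^ H.card) * r ^ 2 := by ring
      _ ≤ ((regularWith V r ∅).card * (r ^ 2) ^ H.card) * r ^ 2 := Nat.mul_le_mul_right _ (ih hH')
      _ = _ := by ring

end


/-! ### The mean number of bad vertices. -/

section

variable {V : Type*} [Fintype V]

/-- The constant in the bound for the mean number of bad vertices. -/
def badConst (r k : ℕ) : ℝ := (k + 1) * ((2 * r) ^ k * (2 ^ ((k + 1).choose 2) * k))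

/-- A set of at most `k` edges on at most `k` vertices has probability `O(1/n)` per edge. -/
lemma card_regularWith_le_real {r k : ℕ} (hr : 1 ≤ r) (hn : 2 * (k + 2 * r + 2) ≤ Fintype.card V)
    {S : Finset V} (hS : S.card ≤ k) {H : Finset (Sym2 V)} (hH : ∀ e ∈ H, ∀ x ∈ e, x ∈ S) :
    ((regularWith V r H).card : ℝ) * (Fintype.card V : ℝ) ^ H.card ≤
      (regularWith V r ∅).card * (2 * r : ℝ) ^ H.card := by
  have h1 := card_regularWith_le (r := r) hS H hH
  -- For large `V` the truncated difference is at least half of $r|V|$, so each prescribed edge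
  -- costs a factor $2r/|V|$.
  have h2 : r * Fintype.card V ≤ 2 * (r * Fintype.card V - r * (k + 2 * r + 2)) := by
    have := Nat.mul_le_mul_left r hn
    have h3 : r * (2 * (k + 2 * r + 2)) = 2 * (r * (k + 2 * r + 2)) := by ring
    omega
  have h3 : (regularWith V r H).card * Fintype.card V ^ H.card * r ^ H.card ≤
      (regularWith V r ∅).card * (2 * r) ^ H.card * r ^ H.card := by
    calc (regularWith V r H).card * Fintype.card V ^ H.card * r ^ H.card
        = (regularWith V r H).card * (r * Fintype.card V) ^ H.card := by rw [mul_pow]; ring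
      _ ≤ (regularWith V r H).card *
          (2 * (r * Fintype.card V - r * (k + 2 * r + 2))) ^ H.card := by gcongr
      _ = (regularWith V r H).card * (r * Fintype.card V - r * (k + 2 * r + 2)) ^ H.card
          * 2 ^ H.card := by rw [mul_pow]; ring
      _ ≤ (regularWith V r ∅).card * (r ^ 2) ^ H.card * 2 ^ H.card := by gcongr
      _ = _ := by rw [mul_pow, sq, mul_pow]; ring
  have h4 := Nat.le_of_mul_le_mul_right h3 (by positivity)
  exact_mod_cast h4

open Classical in
/-- The mean number of bad vertices of a random regular graph is bounded. -/
theorem sum_badVertices_le {r k : ℕ} (hr : 1 ≤ r) (hn : 2 * (k + 2 * r + 2) ≤ Fintype.card V) :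
    ∑ G ∈ regularWith V r ∅, ((badVertices G k).ncard : ℝ) ≤
      badConst r k * (regularWith V r ∅).card := by
  set n := Fintype.card V with hnV
  have hn0 : (0 : ℝ) < n := by
    have : 0 < n := by omega
    exact_mod_cast this
  have hcover : ∀ G ∈ regularWith V r ∅, ((badVertices G k).ncard : ℝ) ≤
      ∑ m ∈ Finset.range (k + 1), ∑ S ∈ Finset.powersetCard m (Finset.univ : Finset V),
        ∑ E ∈ Finset.powersetCard m S.sym2, if G ∈ regularWith V r E then (k : ℝ) else 0 := by
    intro G hG
    set U := (Finset.range (k + 1)).biUnion fun m =>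
      (Finset.powersetCard m (Finset.univ : Finset V)).biUnion fun S =>
        (Finset.powersetCard m S.sym2).biUnion fun E =>
          if G ∈ regularWith V r E then S else ∅ with hU
    have h1 : badVertices G k ⊆ (U : Set V) := by
      rintro v ⟨S, hvS, hSk, E, hE, hES⟩
      simp only [hU, Finset.coe_biUnion, Set.mem_iUnion, Finset.mem_coe]
      refine ⟨S.card, Finset.mem_range.2 (by omega), S, Finset.mem_powersetCard_univ.2 rfl, E,
        Finset.mem_powersetCard.2 ⟨fun e he => Finset.mem_sym2_iff.2 (hES e he).2, hE⟩, ?_⟩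
      rw [if_pos (mem_regularWith.2 ⟨(mem_regularWith.1 hG).1, fun e he => (hES e he).1⟩)]
      exact hvS
    have h2 : (badVertices G k).ncard ≤ U.card := by
      rw [← Set.ncard_coe_finset]
      exact Set.ncard_le_ncard h1
    have h3 : U.card ≤ ∑ m ∈ Finset.range (k + 1),
        ∑ S ∈ Finset.powersetCard m (Finset.univ : Finset V),
        ∑ E ∈ Finset.powersetCard m S.sym2, if G ∈ regularWith V r E then k else 0 := by
      refine Finset.card_biUnion_le.trans (Finset.sum_le_sum fun m hm => ?_)
      refine Finset.card_biUnion_le.trans (Finset.sum_le_sum fun S hS => ?_)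
      refine Finset.card_biUnion_le.trans (Finset.sum_le_sum fun E hE => ?_)
      split_ifs
      · rw [Finset.mem_powersetCard_univ.1 hS]
        exact Nat.lt_succ_iff.1 (Finset.mem_range.1 hm)
      · simp
    exact_mod_cast h2.trans h3
  refine (Finset.sum_le_sum hcover).trans ?_
  rw [Finset.sum_comm]
  have hm : ∀ m ∈ Finset.range (k + 1), (∑ G ∈ regularWith V r ∅,
      ∑ S ∈ Finset.powersetCard m (Finset.univ : Finset V),
        ∑ E ∈ Finset.powersetCard m S.sym2, if G ∈ regularWith V r E then (k : ℝ) else 0) ≤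
      (2 * r : ℝ) ^ k * (2 ^ ((k + 1).choose 2) * k) * (regularWith V r ∅).card := by
    intro m hm
    have hmk : m ≤ k := Nat.lt_succ_iff.1 (Finset.mem_range.1 hm)
    set R : ℝ := ((regularWith V r ∅).card : ℝ) with hR
    have hR0 : 0 ≤ R := Nat.cast_nonneg _
    rw [Finset.sum_comm]
    have hS : ∀ S ∈ Finset.powersetCard m (Finset.univ : Finset V), (∑ G ∈ regularWith V r ∅,
        ∑ E ∈ Finset.powersetCard m S.sym2, if G ∈ regularWith V r E then (k : ℝ) else 0) ≤
        2 ^ ((k + 1).choose 2) * (k * (R * ((2 * r : ℝ) ^ m / n ^ m))) := by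
      intro S hS
      have hSm : S.card = m := Finset.mem_powersetCard_univ.1 hS
      rw [Finset.sum_comm]
      have hE : ∀ E ∈ Finset.powersetCard m S.sym2, (∑ G ∈ regularWith V r ∅,
          if G ∈ regularWith V r E then (k : ℝ) else 0) ≤ k * (R * ((2 * r : ℝ) ^ m / n ^ m)) := by
        intro E hE
        obtain ⟨hES, hEm⟩ := Finset.mem_powersetCard.1 hE
        have h1 := card_regularWith_le_real (V := V) hr hn (S := S) (by omega) (H := E)
          fun e he => Finset.mem_sym2_iff.1 (hES he)
        rw [hEm] at h1
        rw [← Finset.sum_filter, Finset.sum_const, nsmul_eq_mul, mul_comm]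
        refine mul_le_mul_of_nonneg_left ?_ (Nat.cast_nonneg k)
        have h2 : ((Finset.filter (fun G => G ∈ regularWith V r E) (regularWith V r ∅)).card : ℝ) ≤
            (regularWith V r E).card := by
          have : Finset.filter (fun G => G ∈ regularWith V r E) (regularWith V r ∅) ⊆
              regularWith V r E := fun G hG => (Finset.mem_filter.1 hG).2
          exact_mod_cast Finset.card_le_card this
        refine h2.trans ?_
        rw [← mul_div_assoc, le_div_iff₀ (by positivity)]
        exact h1
      refine (Finset.sum_le_sum hE).trans ?_
      rw [Finset.sum_const, nsmul_eq_mul]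
      refine mul_le_mul_of_nonneg_right ?_ (by positivity)
      have h3 : (Finset.powersetCard m S.sym2).card ≤ 2 ^ ((k + 1).choose 2) := by
        calc (Finset.powersetCard m S.sym2).card ≤ S.sym2.powerset.card :=
              Finset.card_le_card fun E hE =>
                Finset.mem_powerset.2 (Finset.mem_powersetCard.1 hE).1
          _ = 2 ^ ((m + 1).choose 2) := by rw [Finset.card_powerset, Finset.card_sym2, hSm]
          _ ≤ 2 ^ ((k + 1).choose 2) :=
              Nat.pow_le_pow_right (by norm_num) (Nat.choose_le_choose 2 (by omega))
      exact_mod_cast h3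
    refine (Finset.sum_le_sum hS).trans ?_
    rw [Finset.sum_const, nsmul_eq_mul, Finset.card_powersetCard, Finset.card_univ]
    have h4 : ((n.choose m : ℕ) : ℝ) ≤ (n : ℝ) ^ m := by exact_mod_cast Nat.choose_le_pow n m
    have h5 : (2 * r : ℝ) ^ m ≤ (2 * r : ℝ) ^ k := by
      have : (1 : ℝ) ≤ r := by exact_mod_cast hr
      exact pow_le_pow_right₀ (by linarith) hmk
    -- The choices of a set of $m$ vertices number at most $n^m$, which cancels the $n^{-m}$ for its
    -- $m$ edges; density is what makes the bound independent of $n$.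
    calc ((n.choose m : ℕ) : ℝ) * (2 ^ ((k + 1).choose 2) * (k * (R * ((2 * r : ℝ) ^ m / n ^ m))))
        ≤ (n : ℝ) ^ m * (2 ^ ((k + 1).choose 2) * (k * (R * ((2 * r : ℝ) ^ m / n ^ m)))) := by
          gcongr
      _ = (2 * r : ℝ) ^ m * (2 ^ ((k + 1).choose 2) * k) * R := by field_simp
      _ ≤ _ := by gcongr
  refine (Finset.sum_le_sum hm).trans (le_of_eq ?_)
  rw [Finset.sum_const, Finset.card_range, nsmul_eq_mul, badConst]
  push_cast
  ring

end

/-! ### Existence of regular graphs and the passage to the random graph. -/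

/-- There are symmetric sets of all admissible sizes in a cyclic group. -/
lemma exists_symmetric_set (n : ℕ) [NeZero n] (r : ℕ) : r < n → Even (r * n) →
    ∃ A : Finset (Fin n), A.card = r ∧ 0 ∉ A ∧ ∀ x ∈ A, -x ∈ A := by
  induction r using Nat.twoStepInduction with
  | zero => exact fun _ _ => ⟨∅, by simp⟩
  | one =>
    intro hn he
    rw [one_mul] at he
    obtain ⟨m, hm⟩ := he
    have hmn : m < n := by omega
    have hneg : -(⟨m, hmn⟩ : Fin n) = ⟨m, hmn⟩ := by
      rw [neg_eq_iff_add_eq_zero]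
      apply Fin.ext
      rw [Fin.val_add]
      simp [← hm]
    refine ⟨{⟨m, hmn⟩}, by simp, ?_, ?_⟩
    · rw [Finset.mem_singleton]
      intro h
      have := congrArg Fin.val h
      simp only [Fin.val_zero] at this
      omega
    · intro x hx
      rw [Finset.mem_singleton] at hx ⊢
      rw [hx, hneg]
  | more r ih _ =>
    intro hn he
    obtain ⟨A, hA, h0, hsymm⟩ := ih (by omega) (by
      have : (r + 2) * n = r * n + 2 * n := by ring
      rw [this] at he
      exact (Nat.even_add.1 he).2 (even_two_mul n))
    have hfix : ∀ x : Fin n, x ≠ 0 → -x = x → 2 * x.val = n := by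
      intro x hx hneg
      rw [neg_eq_iff_add_eq_zero] at hneg
      have h1 := congrArg Fin.val hneg
      rw [Fin.val_add, Fin.val_zero] at h1
      have h2 : x.val ≠ 0 := fun h => hx (Fin.ext h)
      have h3 := x.2
      obtain ⟨c, hc⟩ := Nat.dvd_of_mod_eq_zero h1
      have : c = 1 := by
        rcases c with _ | _ | c
        · omega
        · rfl
        · have : n * (c + 1 + 1) = n * c + 2 * n := by ring
          have := Nat.zero_le (n * c)
          omega
      subst this
      omega
    -- Only one nonzero element can be its own negative, so of two elements outside `A` and `0` one
    -- yields a pair `z`, `-z` to add.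
    have hcard : 1 < ((insert 0 A)ᶜ : Finset (Fin n)).card := by
      rw [Finset.card_compl, Fintype.card_fin, Finset.card_insert_of_notMem h0, hA]
      omega
    obtain ⟨x, hx, y, hy, hxy⟩ := Finset.one_lt_card.1 hcard
    simp only [Finset.mem_compl, Finset.mem_insert, not_or] at hx hy
    obtain ⟨z, hz0, hzA, hz⟩ : ∃ z : Fin n, z ≠ 0 ∧ z ∉ A ∧ -z ≠ z := by
      by_contra! hno
      have h1 := hfix x hx.1 (hno x hx.1 hx.2)
      have h2 := hfix y hy.1 (hno y hy.1 hy.2)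
      exact hxy (Fin.ext (by omega))
    have hnzA : -z ∉ A := fun h => hzA (by simpa using hsymm _ h)
    refine ⟨insert z (insert (-z) A), ?_, ?_, ?_⟩
    · rw [Finset.card_insert_of_notMem, Finset.card_insert_of_notMem hnzA, hA]
      simp only [Finset.mem_insert, not_or]
      exact ⟨hz.symm, hzA⟩
    · simp only [Finset.mem_insert, not_or]
      exact ⟨hz0.symm, by simpa [eq_comm] using hz0, h0⟩
    · intro x hx
      simp only [Finset.mem_insert] at hx ⊢
      rcases hx with rfl | rfl | hx
      · exact Or.inr (Or.inl rfl)
      · exact Or.inl (neg_neg z)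
      · exact Or.inr (Or.inr (hsymm x hx))

/-- Regular graphs exist: a Cayley graph of a cyclic group. -/
lemma regularWith_nonempty {n r : ℕ} (hrn : r < n) (he : Even (r * n)) :
    (regularWith (Fin n) r ∅).Nonempty := by
  have : NeZero n := ⟨by omega⟩
  obtain ⟨A, hA, h0, hsymm⟩ := exists_symmetric_set n r hrn he
  let G : SimpleGraph (Fin n) := SimpleGraph.mk (fun x y => y - x ∈ A)
    ⟨fun x y h => by have := hsymm _ h; rwa [neg_sub] at this⟩
    ⟨fun x h => h0 (by simpa using h)⟩
  refine ⟨G, mem_regularWith.2 ⟨fun a => ?_, by simp⟩⟩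
  have h1 : G.neighborSet a = (fun x => a + x) '' (A : Set (Fin n)) := by
    ext b
    constructor
    · intro h
      exact ⟨b - a, h, by simp⟩
    · rintro ⟨x, hx, rfl⟩
      change a + x - a ∈ A
      simpa using hx
  rw [h1, Set.ncard_image_of_injective _ (add_right_injective a), Set.ncard_coe_finset, hA]

lemma coe_regularWith (n r : ℕ) : (regularWith (Fin n) r ∅ : Set (SimpleGraph (Fin n))) =
    regularGraphs r n := by
  ext G
  simp only [Finset.mem_coe, mem_regularWith, Finset.notMem_empty, false_imp_iff, implies_true,
    and_true, regularGraphs, Set.mem_ofPred_eq, SimpleGraph.IsRegularOfDegree]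
  refine forall_congr' fun a => ?_
  rw [← SimpleGraph.card_neighborFinset_eq_degree, ← Set.ncard_coe_finset,
    SimpleGraph.coe_neighborFinset]

open Classical in
/-- A property that holds for all regular graphs with few bad vertices holds asymptotically almost
surely. -/
theorem aas_of_badVertices {r k : ℕ} (hr : 1 ≤ r) {δ : ℝ} (hδ : 0 < δ)
    {A : (n : ℕ) → Set (SimpleGraph (Fin n))}
    (hA : ∀ n (G : SimpleGraph (Fin n)), (∀ y, (G.neighborSet y).ncard = r) →
      ((badVertices G k).ncard : ℝ) ≤ δ * n → G ∈ A n) : AAS r A := by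
  have hlim : Tendsto (fun n : ℕ => 1 - badConst r k / δ * (1 / (n : ℝ)))
      (atTop ⊓ 𝓟 {n : ℕ | Even (r * n)}) (𝓝 1) := by
    have h1 : Tendsto (fun n : ℕ => 1 - badConst r k / δ * (1 / (n : ℝ))) atTop
        (𝓝 (1 - badConst r k / δ * 0)) :=
      tendsto_const_nhds.sub (tendsto_one_div_atTop_nhds_zero_nat.const_mul _)
    rw [mul_zero, sub_zero] at h1
    exact h1.mono_left inf_le_left
  refine tendsto_of_tendsto_of_tendsto_of_le_of_le' hlim tendsto_const_nhds ?_ ?_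
  · rw [eventually_inf_principal]
    filter_upwards [eventually_ge_atTop (2 * (k + 2 * r + 2))] with n hn he
    set Reg := regularWith (Fin n) r ∅ with hReg
    have hpos : 0 < Reg.card := Finset.card_pos.2 (regularWith_nonempty (by omega) he)
    have hposR : (0 : ℝ) < Reg.card := by exact_mod_cast hpos
    have hn0 : (0 : ℝ) < n := by
      have : 0 < n := by omega
      exact_mod_cast this
    have hden : (regularGraphs r n).ncard = Reg.card := by
      rw [← coe_regularWith, Set.ncard_coe_finset]
    have hnum : (regularGraphs r n ∩ A n).ncard = (Reg.filter fun G => G ∈ A n).card := by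
      rw [← coe_regularWith, ← Set.ncard_coe_finset]
      congr 1
      ext G
      simp [hReg]
    have hsum := sum_badVertices_le (V := Fin n) (r := r) (k := k) hr (by simpa using hn)
    -- Markov's inequality: a graph outside `A n` has more than `δ * n` bad vertices.
    have hmarkov : ((Reg.filter fun G => G ∉ A n).card : ℝ) * (δ * n) ≤
        badConst r k * Reg.card := by
      refine le_trans ?_ hsum
      rw [← nsmul_eq_mul]
      refine (Finset.card_nsmul_le_sum _ (fun G => ((badVertices G k).ncard : ℝ)) _ ?_).trans
        (Finset.sum_le_sum_of_subset_of_nonneg (Finset.filter_subset _ _)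
          fun _ _ _ => Nat.cast_nonneg _)
      intro G hG
      obtain ⟨hG1, hG2⟩ := Finset.mem_filter.1 hG
      by_contra hlt
      exact hG2 (hA n G (mem_regularWith.1 hG1).1 (not_le.1 hlt).le)
    have hsplit : ((Reg.filter fun G => G ∈ A n).card : ℝ) + (Reg.filter fun G => G ∉ A n).card =
        Reg.card := by
      exact_mod_cast Finset.card_filter_add_card_filter_not (s := Reg) fun G => G ∈ A n
    rw [regularProb, hden, hnum, le_div_iff₀ hposR]
    have h2 : ((Reg.filter fun G => G ∉ A n).card : ℝ) ≤
        badConst r k / δ * (1 / (n : ℝ)) * Reg.card := by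
      have h3 : badConst r k / δ * (1 / (n : ℝ)) * Reg.card = badConst r k * Reg.card / (δ * n) := by
        field_simp
      rw [h3, le_div_iff₀ (by positivity)]
      exact hmarkov
    linarith
  · refine Eventually.of_forall fun n => ?_
    refine div_le_one_of_le₀ ?_ (Nat.cast_nonneg _)
    exact_mod_cast Set.ncard_le_ncard Set.inter_subset_left (Set.toFinite _)

end InducedForest

end

theorem corollary1p2 (r : ℕ) (hr : 3 ≤ r) :
    -- the constants `ξ(r, p₀)` and their supremum `ξ(r)` are well defined
    (∀ p₀ ∈ Set.Ioo (0 : ℝ) 1, ∃! v : ℝ, InducedForest.IsXi r p₀ v) ∧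
    IsLUB (InducedForest.xiValues r) (InducedForest.xi r) ∧
    -- `ξ(r)` is at least the tabulated value
    (r ≤ 10 → InducedForest.xiTable r ≤ InducedForest.xi r) ∧
    -- a random `r`-regular graph a.a.s. has an induced forest on `(ξ(r) - ε) n` vertices
    (∀ ε : ℝ, 0 < ε →
      InducedForest.AAS r
        (fun n => {G | InducedForest.HasInducedForest G ((InducedForest.xi r - ε) * n)})) := by
  refine ⟨fun p hp => InducedForest.existsUnique_isXi hr hp, InducedForest.isLUB_xi hr,
    fun h => InducedForest.xiTable_le_xi hr h, fun ε hε => ?_⟩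
  -- Half of `ε` is spent on a value near the supremum; the other half is five times the `ε / 10`
  -- used in `exists_large_forest`.
  obtain ⟨v, hv, hlt, -⟩ := (InducedForest.isLUB_xi hr).exists_between
    (sub_lt_self (InducedForest.xi r) (half_pos hε))
  obtain ⟨p, α, hp0, hp, hα, rfl⟩ := (InducedForest.mem_xiValues_iff hr).1 hv
  obtain ⟨k, hk⟩ := InducedForest.exists_large_forest hα hr hp0 hp (show 0 < ε / 10 by positivity)
  refine InducedForest.aas_of_badVertices (k := k) (by omega) (show 0 < ε / 10 by positivity)
    fun n G hdeg hbad => ?_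
  obtain ⟨S, hS, hcard⟩ := hk n G hdeg hbad
  refine ⟨S, hS, le_trans ?_ hcard⟩
  refine mul_le_mul_of_nonneg_right ?_ (Nat.cast_nonneg n)
  linarith
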